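/- **Conventions.** For integrable $h:\mathbb R\to\mathbb C$ put $\tilde h(k)=\int_{-\infty}^{\infty}h(x)e^{ikx}\,dx$; for a function of $(x,t)$ the tilde is the transform in $x$. Let $E_{a,b}(z)=\sum_{n\ge 0} z^n/\Gamma(na+b)$. For $m-1<\beta\le m$, $m\in\mathbb N$, the Caputo derivative is $$\frac{\partial^\beta N}{\partial t^\beta}(x,t)=\frac1{\Gamma(m-\beta)}\int_0^t (t-\tau)^{m-\beta-1}\,\partial_t^mN(x,\tau)\,d\tau\quad(\beta<m),\qquad \frac{\partial^\beta N}{\partial t^\beta}=\partial_t^mN\quad(\beta=m).$$ For $\alpha>0$ the fractional space derivative ${}_{-\infty}D_x^\alpha$ is taken in the convention in which the imaginary unit is suppressed in Fourier space: for integrable $u$, ${}_{-\infty}D_x^\alpha u$ is the integrable function $v$ (if there is one; it is unique up to null sets) with $\tilde v(k)=-|k|^\alpha\tilde u(k)$ for all $k\in\mathbb R$. **Theorem.** Let $\eta>0$, $\alpha>0$, $0<\beta\le 2$, $m=\lceil\beta\rceil$. Let $f,g:\mathbb R\to\mathbb C$ be integrable with $\tilde f,\tilde g$ integrable. Let $\varphi:\mathbb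 R\times(0,\infty)\to\mathbb C$ be such that, for every $t>0$, $\varphi(\cdot,t)$ is integrable and $(k,s)\mapsto (t-s)^{\beta-1}\tilde\varphi(k,s)$ is integrable on $\mathbb R\times(0,t)$. Let $N:\mathbb R\times[0,\infty)\to\mathbb C$ satisfy $$\frac{\partial^\beta N}{\partial t^\beta}=\eta\;{}_{-\infty}D_x^\alpha N(x,t)+\varphi(x,t)\qquad(x\in\mathbb R,\ t>0),$$ where for each $t>0$ the function ${}_{-\infty}D_x^\alpha N(\cdot,t)$ exists in the above sense, together with $N(x,0)=f(x)$ for all $x\in\mathbb R$ and, if $1<\beta\le2$, also $N_t(x,0)=g(x)$ for all $x\in\mathbb R$ (for $0<\beta\le 1$ only $N(x,0)$ is prescribed). Here the solution $N$ is understood to have the following regularity: $N(\cdot,t)$ is continuous for each $t>0$; for each $x$, $N(x,\cdot)$ is continuous on $[0,\infty)$ and of class $C^m$ on $(0,\infty)$, and $\partial_t^mN(x,\cdot)$ is integrable on $(0,T)$ for all $T>0$; and $\partial_t^mN$ is integrable on $\mathbb R\times(0,T)$ for all $T>0$. Then for all $x\in\mathbb R$ and $t>0$ $$\begin{aligned}N(x,t)={}&\frac1{2\pi}\int_{-\infty}^\infty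 \tilde f(k)\,E_{\beta,1}(-\eta|k|^\alpha t^\beta)\,e^{-ikx}\,dk\\&+\frac{1}{2\pi}\int_{-\infty}^\infty t\,\tilde g(k)\,E_{\beta,2}(-\eta|k|^\alpha t^\beta)\,e^{-ikx}\,dk\\&+\frac1{2\pi}\int_0^t\xi^{\beta-1}\int_{-\infty}^\infty\tilde\varphi(k,t-\xi)\,E_{\beta,\beta}(-\eta|k|^\alpha\xi^\beta)\,e^{-ikx}\,dk\,d\xi,\end{aligned}$$ where the second term is present if $1<\beta\le2$ and is omitted if $0<\beta\le1$. All these integrals converge absolutely (the inner integral in the last term for almost every $\xi\in(0,t)$). -/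

import Mathlib

open MeasureTheory Set

noncomputable section

/-- The two-parameter Mittag-Leffler function `E_{a,b}(z) = ∑ zⁿ / Γ(n a + b)`
(for `Re a > 0` the series converges absolutely for every `z`). -/
def mittagLeffler (a b z : ℂ) : ℂ :=
  ∑' n : ℕ, z ^ n / Complex.Gamma (n * a + b)

/-- The Fourier transform `h̃(q) = ∫ h(x) exp(i q x) dx`. -/
def fourierTilde (h : ℝ → ℂ) (q : ℝ) : ℂ :=
  ∫ x : ℝ, h x * Complex.exp (Complex.I * q * x)

/-- The Caputo derivative of order `β > 0` at `t > 0`, with `m = ⌈β⌉`, `m - 1 < β ≤ m`: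
`(1 / Γ(m - β)) ∫₀ᵗ (t - τ)^(m - β - 1) u⁽ᵐ⁾(τ) dτ` if `β < m`, and `u⁽ᵐ⁾(t)` if `β = m`. -/
def caputoDeriv (β : ℝ) (u : ℝ → ℂ) (t : ℝ) : ℂ :=
  if β = (⌈β⌉₊ : ℝ) then iteratedDeriv ⌈β⌉₊ u t
  else ((1 / Real.Gamma ((⌈β⌉₊ : ℝ) - β) : ℝ) : ℂ) *
    ∫ τ in (0 : ℝ)..t, (((t - τ) ^ ((⌈β⌉₊ : ℝ) - β - 1) : ℝ) : ℂ) * iteratedDeriv ⌈β⌉₊ u τ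

/-- `v` is the fractional space derivative `₋∞D_x^α u`, in the convention in which the imaginary
unit is suppressed in Fourier space: `u`, `v` are integrable and `ṽ(k) = -|k|^α ũ(k)` for all `k`.
By injectivity of the Fourier transform, `v` is determined by `u` up to a null set. -/
structure HasSpaceDeriv (α : ℝ) (u v : ℝ → ℂ) : Prop where
  integrable_left : Integrable u
  integrable_right : Integrable v
  symbol : ∀ k : ℝ, fourierTilde v k = -(((|k| ^ α : ℝ) : ℂ)) * fourierTilde u k

/-- `N` (read as `N x t`, only values at `t ≥ 0` matter) is a solution of
`∂^β N/∂t^β = η ₋∞D_x^α N + φ(x,t)`, `x ∈ ℝ`, `t > 0`, with `N(x,0) = f(x)` and, when `1 < β`,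
`N_t(x,0) = g(x)`.  Regularity: `N(·,t)` is continuous; `N(x,·)` is continuous on `[0,∞)`,
of class `C^m` on `(0,∞)`, `m = ⌈β⌉`; and `∂_t^m N` is integrable on each `(0,T)` for each `x`
and on each strip `ℝ × (0,T)`. -/
structure IsSolution (η α β : ℝ) (φ : ℝ → ℝ → ℂ) (f g : ℝ → ℂ) (N : ℝ → ℝ → ℂ) : Prop where
  continuous_space : ∀ t : ℝ, 0 < t → Continuous fun x => N x t
  continuous_time : ∀ x : ℝ, ContinuousOn (N x) (Ici 0)
  contDiff_time : ∀ x : ℝ, ContDiffOn ℝ (⌈β⌉₊ : ℕ) (N x) (Ioi 0)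
  intervalIntegrable_time : ∀ x T : ℝ, 0 < T →
    IntervalIntegrable (iteratedDeriv ⌈β⌉₊ (N x)) volume 0 T
  integrable_strip : ∀ T : ℝ, 0 < T →
    Integrable (fun p : ℝ × ℝ => iteratedDeriv ⌈β⌉₊ (N p.1) p.2)
      (volume.prod (volume.restrict (Ioo 0 T)))
  equation : ∀ t : ℝ, 0 < t → ∃ v : ℝ → ℂ, HasSpaceDeriv α (fun x => N x t) v ∧
    ∀ x : ℝ, caputoDeriv β (N x) t = (η : ℂ) * v x + φ x t
  initial_value : ∀ x : ℝ, N x 0 = f x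
  initial_velocity : 1 < β → ∀ x : ℝ, HasDerivWithinAt (N x) (g x) (Ici 0) 0

end

/-! The transform in `x` turns the equation, for each fixed `k`, into a fractional relaxation
equation in time with rate `l = η|k|^α ≥ 0`. It is solved by variation of constants, without Laplace
transforms. Write `W(τ)` for the transform of `∂_t^m N(·,τ)`. Taylor's formula in time gives `Ñ` as
a polynomial in the initial data plus the fractional integral of order `m` of `W`. The equation
gives `φ̃ = l Ñ + V`, where `V`, the Caputo derivative of `Ñ`, is the fractional integral of order
`m - β` of `W` (or `W` itself if `β = m`).

Convolving `φ̃` with the resolvent kernel `s^(β-1) E_{β,β}(-l s^β)` (`mlKernel`) expresses every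
term through fractional integrals of Mittag-Leffler functions
(`setIntegral_rpow_mul_mittagLeffler`). The recursion `E_{β,b}(z) = 1/Γ(b) + z E_{β,b+β}(z)` then
eliminates `W` and leaves the formula for `Ñ(k,t)` (`eq_mittagLeffler_of_convolution`).

Fourier inversion needs `Ñ(·,t)` integrable, hence bounds on `E_{β,1}`, `E_{β,2}`, `E_{β,β}` over
the negative axis that are uniform in `k`. They all come from `|E_{γ,1}| ≤ 1` on the closed left
half-plane for `0 < γ ≤ 1` (`norm_mittagLeffler_one_le`), proved by a maximum principle for the
Caputo derivative. For `1 < β ≤ 2` the duplication formula reduces `E_{β,1}` to `E_{β/2,1}` on the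
imaginary axis. -/

/-! ### Convergence, recursion and differentiation of the Mittag-Leffler series -/

lemma rpow_mul_exp_neg_le_Gamma {R s : ℝ} (hR : 0 < R) (hs : 1 ≤ s) :
    R ^ (s - 1) * Real.exp (-R) ≤ Real.Gamma s := by
  have hs0 : 0 < s := by linarith
  rw [Real.Gamma_eq_integral hs0, ← integral_exp_neg_Ioi, ← integral_const_mul]
  have hint := Real.GammaIntegral_convergent hs0
  have hsub : Ioi R ⊆ Ioi (0 : ℝ) := Ioi_subset_Ioi hR.le
  calc ∫ x in Ioi R, R ^ (s - 1) * Real.exp (-x)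
      ≤ ∫ x in Ioi R, Real.exp (-x) * x ^ (s - 1) := by
        refine setIntegral_mono_on ((integrableOn_exp_neg_Ioi R).const_mul _)
          (hint.mono_set hsub) measurableSet_Ioi fun x hx => ?_
        rw [mul_comm]
        have hx' : R < x := hx
        gcongr
    _ ≤ _ := by
        refine setIntegral_mono_set hint ?_ (Filter.Eventually.of_forall hsub)
        filter_upwards [ae_restrict_mem measurableSet_Ioi] with x hx
        have hx' : 0 < x := hx
        positivity

/-- The tail of the Gamma integral beyond `R` makes `Γ(na+b)` grow at least like `(R^a)^n` for every
`R`. Taking `R^a = 2x+2` gives a geometric majorant of ratio `1/2`, valid once `na+b ≥ 1`. -/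
lemma summable_pow_div_Gamma {a b x : ℝ} (ha : 0 < a) (hx : 0 ≤ x) :
    Summable fun n : ℕ => x ^ n / Real.Gamma (n * a + b) := by
  set R : ℝ := (2 * x + 2) ^ (1 / a) with hRdef
  have hR : 0 < R := by positivity
  have hRa : R ^ a = 2 * x + 2 := by
    rw [hRdef, ← Real.rpow_mul (by positivity), one_div_mul_cancel ha.ne', Real.rpow_one]
  have hg : Summable fun n : ℕ => (R ^ (b - 1) * Real.exp (-R))⁻¹ * (1 / 2 : ℝ) ^ n :=
    (summable_geometric_of_lt_one (by norm_num) (by norm_num)).mul_left _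
  refine Summable.of_norm_bounded_eventually_nat hg ?_
  have hev : ∀ᶠ n : ℕ in Filter.atTop, (1 - b) / a ≤ n :=
    tendsto_natCast_atTop_atTop.eventually_ge_atTop _
  filter_upwards [hev] with n hn
  have h1 : 1 ≤ n * a + b := by
    rw [div_le_iff₀ ha] at hn; linarith
  have hG := rpow_mul_exp_neg_le_Gamma hR h1
  have hpow : R ^ (n * a + b - 1) = (2 * x + 2) ^ n * R ^ (b - 1) := by
    rw [← hRa, ← Real.rpow_natCast (R ^ a), ← Real.rpow_mul hR.le, ← Real.rpow_add hR]
    congr 1; ring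
  have hGpos : 0 < Real.Gamma (n * a + b) := Real.Gamma_pos_of_pos (by linarith)
  rw [Real.norm_of_nonneg (by positivity)]
  rw [hpow] at hG
  have hc : 0 < R ^ (b - 1) * Real.exp (-R) := by positivity
  calc x ^ n / Real.Gamma (n * a + b)
      ≤ x ^ n / ((2 * x + 2) ^ n * R ^ (b - 1) * Real.exp (-R)) := by gcongr
    _ = (R ^ (b - 1) * Real.exp (-R))⁻¹ * (x / (2 * x + 2)) ^ n := by
        rw [div_pow]; field_simp
    _ ≤ _ := by
        have : x / (2 * x + 2) ≤ 1 / 2 := by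
          rw [div_le_div_iff₀ (by linarith) (by norm_num)]; linarith
        gcongr

lemma Gamma_natCast_mul_add (a b : ℝ) (n : ℕ) :
    Complex.Gamma (n * (a : ℂ) + b) = ((Real.Gamma (n * a + b) : ℝ) : ℂ) := by
  rw [← Complex.Gamma_ofReal]; push_cast; rfl

lemma norm_mittagLeffler_term (a b : ℝ) (ha : 0 < a) (hb : 0 < b) (z : ℂ) (n : ℕ) :
    ‖z ^ n / Complex.Gamma (n * (a : ℂ) + b)‖ = ‖z‖ ^ n / Real.Gamma (n * a + b) := by
  have : 0 < Real.Gamma (n * a + b) := Real.Gamma_pos_of_pos (by positivity)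
  rw [Gamma_natCast_mul_add, norm_div, norm_pow, Complex.norm_real, Real.norm_of_nonneg this.le]

lemma hasSum_mittagLeffler {a b : ℝ} (ha : 0 < a) (hb : 0 < b) (z : ℂ) :
    HasSum (fun n : ℕ => z ^ n / Complex.Gamma (n * (a : ℂ) + b)) (mittagLeffler a b z) := by
  refine Summable.hasSum (Summable.of_norm ?_)
  simp_rw [norm_mittagLeffler_term a b ha hb]
  exact summable_pow_div_Gamma ha (norm_nonneg _)

/-- Splitting off the term `n = 0`. This recursion is the algebraic core of the variation of
constants formula. -/
lemma mittagLeffler_eq_inv_Gamma_add {a b : ℝ} (ha : 0 < a) (hb : 0 < b) (z : ℂ) :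
    mittagLeffler a b z = 1 / ((Real.Gamma b : ℝ) : ℂ) + z * mittagLeffler a (b + a : ℝ) z := by
  have h := (hasSum_mittagLeffler ha hb z).tsum_eq
  rw [← h, (hasSum_mittagLeffler ha hb z).summable.tsum_eq_zero_add,
    ← (hasSum_mittagLeffler ha (add_pos hb ha) z).tsum_eq, ← tsum_mul_left]
  congr 1
  · simp [Complex.Gamma_ofReal]
  · refine tsum_congr fun n => ?_
    rw [pow_succ']
    push_cast
    rw [show ((n : ℂ) + 1) * a + b = n * a + (b + a) by ring]
    ring

lemma mittagLeffler_zero {a b : ℝ} (ha : 0 < a) (hb : 0 < b) :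
    mittagLeffler a b 0 = 1 / ((Real.Gamma b : ℝ) : ℂ) := by
  rw [mittagLeffler_eq_inv_Gamma_add ha hb]; simp

lemma differentiable_mittagLeffler {a b : ℝ} (ha : 0 < a) (hb : 0 < b) :
    Differentiable ℂ (mittagLeffler a b) := by
  intro z
  have h := Complex.differentiableOn_tsum_of_summable_norm
    (F := fun (n : ℕ) (w : ℂ) => w ^ n / Complex.Gamma (n * (a : ℂ) + b))
    (U := Metric.ball 0 (‖z‖ + 1))
    (summable_pow_div_Gamma (b := b) ha (by positivity : 0 ≤ ‖z‖ + 1))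
    (fun i => by fun_prop) Metric.isOpen_ball
    (fun i w hw => by
      rw [norm_mittagLeffler_term a b ha hb]
      have : 0 < Real.Gamma (i * a + b) := Real.Gamma_pos_of_pos (by positivity)
      have hw' : ‖w‖ ≤ ‖z‖ + 1 := by simpa using (mem_ball_zero_iff.1 hw).le
      gcongr)
  exact h.differentiableAt (Metric.isOpen_ball.mem_nhds (by simp))

lemma continuous_mittagLeffler {a b : ℝ} (ha : 0 < a) (hb : 0 < b) :
    Continuous (mittagLeffler a b) := (differentiable_mittagLeffler ha hb).continuous

/-- Termwise differentiation and `Γ(w+1) = wΓ(w)` with `w = (n+1)a`. It gives the time derivative of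
`E_{a,1}(z s^a)`, and lets bounds on `E_{a,1}` pass to `E_{a,a}` by Cauchy's estimate. -/
lemma mul_deriv_mittagLeffler_one {a : ℝ} (ha : 0 < a) (z : ℂ) :
    (a : ℂ) * deriv (mittagLeffler a 1) z = mittagLeffler a a z := by
  have h1 : (1 : ℂ) = ((1 : ℝ) : ℂ) := by simp
  have h := Complex.hasSum_deriv_of_summable_norm (z := z)
    (F := fun (n : ℕ) (w : ℂ) => w ^ n / Complex.Gamma (n * (a : ℂ) + 1))
    (U := Metric.ball 0 (‖z‖ + 1))
    (summable_pow_div_Gamma (b := 1) ha (by positivity : 0 ≤ ‖z‖ + 1))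
    (fun i => by fun_prop) Metric.isOpen_ball
    (fun i w hw => by
      rw [h1, norm_mittagLeffler_term a 1 ha one_pos]
      have : 0 < Real.Gamma (i * a + 1) := Real.Gamma_pos_of_pos (by positivity)
      have hw' : ‖w‖ ≤ ‖z‖ + 1 := by simpa using (mem_ball_zero_iff.1 hw).le
      gcongr) (by simp)
  have h2 : HasSum (fun n : ℕ => deriv (fun w : ℂ => w ^ n / Complex.Gamma (n * (a : ℂ) + 1)) z)
    (deriv (mittagLeffler a 1) z) := h
  rw [← h2.tsum_eq, ← tsum_mul_left,
    (h2.summable.mul_left (a : ℂ)).tsum_eq_zero_add, ← (hasSum_mittagLeffler ha ha z).tsum_eq]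
  simp only [deriv_div_const, pow_zero, deriv_const, zero_div, mul_zero, zero_add]
  refine tsum_congr fun n => ?_
  have hpos : 0 < n * a + a := by positivity
  have hne : ((n : ℂ) + 1) * a ≠ 0 := by
    exact_mod_cast (by positivity : ((n : ℝ) + 1) * a ≠ 0)
  rw [Nat.cast_succ, Complex.Gamma_add_one _ hne, show ((n : ℂ) + 1) * a = n * a + a by ring,
    Gamma_natCast_mul_add]
  have hG : ((Real.Gamma (n * a + a) : ℝ) : ℂ) ≠ 0 := by
    exact_mod_cast (Real.Gamma_pos_of_pos hpos).ne'
  have hd : deriv (fun w : ℂ => w ^ (n + 1)) z = (n + 1) * z ^ n := by simp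
  rw [hd]
  have ha' : (a : ℂ) ≠ 0 := by exact_mod_cast ha.ne'
  have hn' : (n : ℂ) + 1 ≠ 0 := by exact_mod_cast Nat.succ_ne_zero n
  rw [show (n : ℂ) * a + a = (n + 1) * a by ring] at *
  field_simp

/-! ### Beta integrals and fractional integrals of Mittag-Leffler functions -/

lemma integral_beta_scaled {u v y : ℝ} (hu : 0 < u) (hv : 0 < v) (hy : 0 < y) :
    ∫ s in (0 : ℝ)..y, s ^ (u - 1) * (y - s) ^ (v - 1) =
      y ^ (u + v - 1) * (Real.Gamma u * Real.Gamma v / Real.Gamma (u + v)) := by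
  have h := Complex.betaIntegral_scaled u v hy
  have hb := Complex.Gamma_mul_Gamma_eq_betaIntegral (s := u) (t := v) (by simpa) (by simpa)
  have hG : Complex.Gamma ((u : ℂ) + v) ≠ 0 := by
    rw [← Complex.ofReal_add, Complex.Gamma_ofReal]
    exact_mod_cast (Real.Gamma_pos_of_pos (add_pos hu hv)).ne'
  have hb' : (u : ℂ).betaIntegral v =
      ((Real.Gamma u * Real.Gamma v / Real.Gamma (u + v) : ℝ) : ℂ) := by
    push_cast
    rw [← Complex.Gamma_ofReal, ← Complex.Gamma_ofReal, ← Complex.Gamma_ofReal, hb,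
      Complex.ofReal_add]
    field_simp
  rw [hb'] at h
  apply Complex.ofReal_injective
  rw [← intervalIntegral.integral_ofReal, Complex.ofReal_mul, Complex.ofReal_cpow hy.le]
  push_cast at h ⊢
  rw [← h]
  refine intervalIntegral.integral_congr fun s hs => ?_
  rw [uIcc_of_le hy.le] at hs
  rw [Complex.ofReal_cpow hs.1, Complex.ofReal_cpow (sub_nonneg.2 hs.2)]
  push_cast
  rfl

lemma integrableOn_beta_scaled {u v y : ℝ} (hu : 0 < u) (hv : 0 < v) (hy : 0 < y) :
    IntegrableOn (fun s : ℝ => s ^ (u - 1) * (y - s) ^ (v - 1)) (Ioo 0 y) := by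
  have h := integral_beta_scaled hu hv hy
  -- The integral of a non-integrable function is `0` by convention, so a nonzero value forces
  -- integrability.
  have hne : ∫ s in (0 : ℝ)..y, s ^ (u - 1) * (y - s) ^ (v - 1) ≠ 0 := by
    rw [h]
    have := Real.Gamma_pos_of_pos hu
    have := Real.Gamma_pos_of_pos hv
    have := Real.Gamma_pos_of_pos (add_pos hu hv)
    positivity
  have := intervalIntegral.intervalIntegrable_of_integral_ne_zero hne
  exact ((intervalIntegrable_iff_integrableOn_Ioo_of_le hy.le).1 this)

lemma setIntegral_beta_scaled {u v y : ℝ} (hu : 0 < u) (hv : 0 < v) (hy : 0 < y) :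
    ∫ s in Ioo 0 y, s ^ (u - 1) * (y - s) ^ (v - 1) =
      y ^ (u + v - 1) * (Real.Gamma u * Real.Gamma v / Real.Gamma (u + v)) := by
  rw [← integral_beta_scaled hu hv hy, intervalIntegral.integral_of_le hy.le,
    integral_Ioc_eq_integral_Ioo]

/-- Riemann–Liouville fractional integral of `s ^ (b - 1) E_{a,b}(z s ^ a)`. -/
lemma setIntegral_rpow_mul_mittagLeffler {a b c y : ℝ} (ha : 0 < a) (hb : 0 < b) (hc : 0 < c)
    (hy : 0 < y) (z : ℂ) :
    ∫ s in Ioo 0 y, (((y - s) ^ (c - 1) : ℝ) : ℂ) * (((s ^ (b - 1) : ℝ) : ℂ) *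
        mittagLeffler a b (z * ((s ^ a : ℝ) : ℂ))) =
      ((Real.Gamma c * y ^ (b + c - 1) : ℝ) : ℂ) *
        mittagLeffler a (b + c : ℝ) (z * ((y ^ a : ℝ) : ℂ)) := by
  -- Expand the series: each term is a Beta integral whose Gamma factors shift `b` to `b+c`. The
  -- norms of the terms integrate to a series of the same type, which justifies the exchange.
  set F : ℕ → ℝ → ℂ := fun n s => (z ^ n / ((Real.Gamma (n * a + b) : ℝ) : ℂ)) *
    ((s ^ (n * a + b - 1) * (y - s) ^ (c - 1) : ℝ) : ℂ) with hF
  have hpos : ∀ n : ℕ, 0 < n * a + b := fun n => by positivity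
  have hint : ∀ n, Integrable (F n) (volume.restrict (Ioo 0 y)) := fun n =>
    ((integrableOn_beta_scaled (hpos n) hc hy).ofReal).const_mul _
  have hval : ∀ n, ∫ s in Ioo 0 y, F n s = ((Real.Gamma c * y ^ (b + c - 1) : ℝ) : ℂ) *
      ((z * ((y ^ a : ℝ) : ℂ)) ^ n / Complex.Gamma (n * (a : ℂ) + (b + c : ℝ))) := fun n => by
    simp only [hF]
    rw [integral_const_mul, integral_complex_ofReal, setIntegral_beta_scaled (hpos n) hc hy,
      Gamma_natCast_mul_add, show n * a + b + c - 1 = (a * n) + (b + c - 1) by ring,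
      Real.rpow_add hy, Real.rpow_mul hy.le, Real.rpow_natCast]
    have h1 : ((Real.Gamma (n * a + b) : ℝ) : ℂ) ≠ 0 := by
      exact_mod_cast (Real.Gamma_pos_of_pos (hpos n)).ne'
    have h2 : ((Real.Gamma (n * a + (b + c)) : ℝ) : ℂ) ≠ 0 := by
      exact_mod_cast (Real.Gamma_pos_of_pos (by positivity)).ne'
    rw [show n * a + b + c = n * a + (b + c) by ring]
    push_cast
    rw [mul_pow]
    field_simp
  have hnorm : ∀ n, ∫ s in Ioo 0 y, ‖F n s‖ = (Real.Gamma c * y ^ (b + c - 1)) *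
      ((‖z‖ * y ^ a) ^ n / Real.Gamma (n * a + (b + c))) := fun n => by
    have : ∫ s in Ioo 0 y, ‖F n s‖ = ∫ s in Ioo 0 y, (‖z‖ ^ n / Real.Gamma (n * a + b)) *
        (s ^ (n * a + b - 1) * (y - s) ^ (c - 1)) := by
      refine setIntegral_congr_fun measurableSet_Ioo fun s hs => ?_
      have h1 : 0 < s := hs.1
      have h2 : 0 < y - s := sub_pos.2 hs.2
      simp only [hF]
      rw [norm_mul, norm_div, norm_pow, Complex.norm_real, Complex.norm_real,
        Real.norm_of_nonneg (Real.Gamma_pos_of_pos (hpos n)).le,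
        Real.norm_of_nonneg (by positivity)]
    rw [this, integral_const_mul, setIntegral_beta_scaled (hpos n) hc hy,
      show n * a + b + c - 1 = (a * n) + (b + c - 1) by ring,
      Real.rpow_add hy, Real.rpow_mul hy.le, Real.rpow_natCast,
      show n * a + b + c = n * a + (b + c) by ring]
    have h1 := (Real.Gamma_pos_of_pos (hpos n)).ne'
    have h2 := (Real.Gamma_pos_of_pos (by positivity : 0 < n * a + (b + c))).ne'
    rw [mul_pow]
    field_simp
  have hsum : Summable fun n => ∫ s in Ioo 0 y, ‖F n s‖ := by
    simp_rw [hnorm]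
    exact (summable_pow_div_Gamma ha (by positivity)).mul_left _
  have key := hasSum_integral_of_summable_integral_norm hint hsum
  have hR := (hasSum_mittagLeffler ha (add_pos hb hc) (z * ((y ^ a : ℝ) : ℂ))).mul_left
    ((Real.Gamma c * y ^ (b + c - 1) : ℝ) : ℂ)
  simp_rw [hval] at key
  rw [← hR.unique key |>.symm]
  refine setIntegral_congr_fun measurableSet_Ioo fun s hs => ?_
  have h1 : 0 < s := hs.1
  have h3 := ((hasSum_mittagLeffler ha hb (z * ((s ^ a : ℝ) : ℂ))).mul_left
    ((((y - s) ^ (c - 1) : ℝ) : ℂ) * (((s ^ (b - 1) : ℝ) : ℂ)))).tsum_eq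
  rw [← mul_assoc, ← h3]
  refine tsum_congr fun n => ?_
  simp only [hF]
  rw [show n * a + b - 1 = (a * n) + (b - 1) by ring, Real.rpow_add h1, Real.rpow_mul h1.le,
    Real.rpow_natCast, Gamma_natCast_mul_add]
  push_cast
  ring

lemma continuous_mittagLeffler_rpow {a b : ℝ} (ha : 0 < a) (hb : 0 < b) (z : ℂ) :
    Continuous fun s : ℝ => mittagLeffler a b (z * ((s ^ a : ℝ) : ℂ)) :=
  (continuous_mittagLeffler ha hb).comp
    (continuous_const.mul (Complex.continuous_ofReal.comp (Real.continuous_rpow_const ha.le)))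

lemma integrableOn_rpow_mul_mittagLeffler {a b c y : ℝ} (ha : 0 < a) (hb : 0 < b) (hc : 0 < c)
    (hy : 0 < y) (z : ℂ) :
    IntegrableOn (fun s : ℝ => (((y - s) ^ (c - 1) : ℝ) : ℂ) * (((s ^ (b - 1) : ℝ) : ℂ) *
        mittagLeffler a b (z * ((s ^ a : ℝ) : ℂ)))) (Ioo 0 y) := by
  have h1 : IntegrableOn (fun s : ℝ => ((s ^ (b - 1) * (y - s) ^ (c - 1) : ℝ) : ℂ)) (Icc 0 y) :=
    ((integrableOn_Icc_iff_integrableOn_Ioo).2 (integrableOn_beta_scaled hb hc hy)).ofReal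
  refine ((h1.mul_continuousOn (continuous_mittagLeffler_rpow ha hb z).continuousOn
    isCompact_Icc).mono_set Ioo_subset_Icc_self).congr (ae_of_all _ fun s => ?_)
  push_cast
  ring

lemma hasDerivAt_mittagLeffler_rpow {a s : ℝ} (ha : 0 < a) (hs : 0 < s) (z : ℂ) :
    HasDerivAt (fun s : ℝ => mittagLeffler a 1 (z * ((s ^ a : ℝ) : ℂ)))
      (z * (((s ^ (a - 1) : ℝ) : ℂ) * mittagLeffler a a (z * ((s ^ a : ℝ) : ℂ)))) s := by
  have h1 : HasDerivAt (fun s : ℝ => z * ((s ^ a : ℝ) : ℂ)) (z * ((a * s ^ (a - 1) : ℝ) : ℂ)) s :=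
    ((Real.hasDerivAt_rpow_const (Or.inl hs.ne')).ofReal_comp).const_mul z
  have h0 := differentiable_mittagLeffler ha one_pos (z * ((s ^ a : ℝ) : ℂ))
  rw [Complex.ofReal_one] at h0
  have h2 := h0.hasDerivAt.comp s h1
  refine h2.congr_deriv ?_
  rw [← mul_deriv_mittagLeffler_one ha]
  push_cast
  ring

/-! ### Bounds in the left half-plane and on the negative axis -/

/-- Maximum principle: `u(s) = E_{γ,1}(z s^γ)` has Caputo derivative `z u` of order `γ`. If `|u|` is
maximal on `[0,1]` at `s = 1`, with `w = u(1)`, then `q = Re(w̄(u - w))` is nonpositive and vanishes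
at `1`. Integrating `(1-s)^(-γ) q'` by parts compares `-q(0)` with `Γ(1-γ)|w|² Re z ≤ 0`. -/
lemma norm_mittagLeffler_one_le_of_forall_segment {γ : ℝ} (h0 : 0 < γ) (h1 : γ < 1) {z : ℂ}
    (hz : z.re ≤ 0)
    (hmax : ∀ τ ∈ Icc (0 : ℝ) 1, ‖mittagLeffler γ 1 (z * τ)‖ ≤ ‖mittagLeffler γ 1 z‖) :
    ‖mittagLeffler γ 1 z‖ ≤ 1 := by
  set w : ℂ := mittagLeffler γ 1 z with hw
  set q : ℝ → ℝ := fun s =>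
    (starRingEnd ℂ w * (mittagLeffler γ 1 (z * ((s ^ γ : ℝ) : ℂ)) - w)).re with hq
  set q' : ℝ → ℝ := fun s => (starRingEnd ℂ w * (z * (((s ^ (γ - 1) : ℝ) : ℂ) *
    mittagLeffler γ γ (z * ((s ^ γ : ℝ) : ℂ))))).re with hq'
  have hcont : Continuous q := by
    have := continuous_mittagLeffler_rpow h0 one_pos z
    rw [Complex.ofReal_one] at this
    exact Complex.continuous_re.comp (continuous_const.mul (this.sub continuous_const))
  have hder : ∀ s, 0 < s → HasDerivAt q (q' s) s := fun s hs => by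
    have := ((hasDerivAt_mittagLeffler_rpow h0 hs z).sub_const w).const_mul (starRingEnd ℂ w)
    exact Complex.reCLM.hasFDerivAt.comp_hasDerivAt s this
  have hww : (starRingEnd ℂ w * w).re = ‖w‖ ^ 2 := by
    rw [mul_comm, Complex.mul_conj, Complex.normSq_eq_norm_sq, Complex.ofReal_re]
  have hqle : ∀ s ∈ Icc (0 : ℝ) 1, q s ≤ 0 := fun s hs => by
    have hτ : s ^ γ ∈ Icc (0 : ℝ) 1 :=
      ⟨Real.rpow_nonneg hs.1 _, Real.rpow_le_one hs.1 hs.2 h0.le⟩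
    have hn : (starRingEnd ℂ w * mittagLeffler γ 1 (z * ((s ^ γ : ℝ) : ℂ))).re ≤ ‖w‖ * ‖w‖ :=
      (Complex.re_le_norm _).trans (by
        rw [norm_mul, RCLike.norm_conj]
        exact mul_le_mul_of_nonneg_left (hmax _ hτ) (norm_nonneg _))
    simp only [hq]
    rw [mul_sub, Complex.sub_re, hww]
    nlinarith
  have hq1 : q 1 = 0 := by simp [hq, hw]
  have hq0 : q 0 = w.re - ‖w‖ ^ 2 := by
    have := mittagLeffler_zero h0 one_pos
    rw [Complex.ofReal_one] at this
    simp only [hq]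
    rw [mul_sub, Complex.sub_re, hww, Real.zero_rpow h0.ne', Complex.ofReal_zero, mul_zero, this]
    simp
  set G : ℝ → ℝ := fun s => (1 - s) ^ (-γ) * q s with hG
  have hGc : ContinuousOn G (Icc 0 1) := by
    intro s hs
    rcases hs.2.lt_or_eq with hlt | rfl
    · refine ContinuousAt.continuousWithinAt ?_
      exact ((continuousAt_const.sub continuousAt_id).rpow_const
        (Or.inl (sub_pos.2 hlt).ne')).mul hcont.continuousAt
    -- Since `q` is differentiable with `q(1) = 0`, the product is `O((1-s)^(1-γ))`, so it extends
    -- continuously by the value `0`, which is `G 1`.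
    · have hO := (hder 1 one_pos).isBigO_sub
      obtain ⟨C, hC⟩ := hO.bound
      have hlim : Filter.Tendsto (fun x : ℝ => C * (1 - x) ^ (1 - γ)) (nhdsWithin 1 (Icc 0 1))
          (nhds 0) := by
        have hc : Continuous fun x : ℝ => C * (1 - x) ^ (1 - γ) :=
          continuous_const.mul ((continuous_const.sub continuous_id).rpow_const
            fun x => Or.inr (by linarith))
        have := hc.tendsto 1
        simp only [sub_self, Real.zero_rpow (sub_pos.2 h1).ne', mul_zero] at this
        exact this.mono_left nhdsWithin_le_nhds
      have hG1 : G 1 = 0 := by simp [hG, hq1]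
      rw [ContinuousWithinAt, hG1]
      refine squeeze_zero_norm' ?_ hlim
      filter_upwards [nhdsWithin_le_nhds hC, self_mem_nhdsWithin] with x hx hxI
      rw [hq1, sub_zero, Real.norm_eq_abs (x - 1), abs_sub_comm,
        abs_of_nonneg (sub_nonneg.2 hxI.2)] at hx
      rcases hxI.2.lt_or_eq with hlt | rfl
      · have hp : 0 < 1 - x := sub_pos.2 hlt
        rw [hG, norm_mul, Real.norm_of_nonneg (Real.rpow_nonneg hp.le _)]
        calc (1 - x) ^ (-γ) * ‖q x‖ ≤ (1 - x) ^ (-γ) * (C * (1 - x)) := by gcongr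
          _ = C * ((1 - x) ^ (-γ) * (1 - x) ^ (1 : ℝ)) := by rw [Real.rpow_one]; ring
          _ = C * (1 - x) ^ (1 - γ) := by rw [← Real.rpow_add hp]; ring_nf
      · simp [hG1, Real.zero_rpow (sub_pos.2 h1).ne']
  have hint := integrableOn_rpow_mul_mittagLeffler h0 h0 (sub_pos.2 h1) one_pos z
  have hval := setIntegral_rpow_mul_mittagLeffler h0 h0 (sub_pos.2 h1) one_pos z
  set φ : ℝ → ℝ := fun s => (1 - s) ^ (-γ) * q' s with hφ
  have hφ' : ∀ s, φ s = Complex.reCLM ((starRingEnd ℂ w * z) * ((((1 - s) ^ (1 - γ - 1) : ℝ) : ℂ) *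
      (((s ^ (γ - 1) : ℝ) : ℂ) * mittagLeffler γ γ (z * ((s ^ γ : ℝ) : ℂ))))) := fun s => by
    rw [hφ, show 1 - γ - 1 = -γ by ring, Complex.reCLM_apply]
    simp only [hq']
    rw [← Complex.re_ofReal_mul]
    congr 1
    ring
  have hφint : IntegrableOn φ (Icc 0 1) := by
    rw [integrableOn_Icc_iff_integrableOn_Ioo]
    refine Integrable.congr ?_ (ae_of_all _ fun s => (hφ' s).symm)
    exact Complex.reCLM.integrable_comp (hint.const_mul _)
  -- This is the Caputo equation at `s = 1`: the fractional integral of order `1-γ` raises the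
  -- second index from `γ` to `1` and returns `w`.
  have hφval : ∫ s in (0 : ℝ)..1, φ s = Real.Gamma (1 - γ) * (‖w‖ ^ 2 * z.re) := by
    rw [intervalIntegral.integral_of_le zero_le_one, integral_Ioc_eq_integral_Ioo]
    simp_rw [hφ']
    rw [Complex.reCLM.integral_comp_comm (hint.const_mul _), integral_const_mul, hval]
    have : γ + (1 - γ) = 1 := by ring
    rw [this, Complex.ofReal_one]
    simp only [sub_self, Real.rpow_zero, Real.one_rpow, mul_one, Complex.ofReal_one,
      Complex.reCLM_apply]
    rw [← hw]
    have h3 : starRingEnd ℂ w * z * (((Real.Gamma (1 - γ) : ℝ) : ℂ) * w) =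
      ((Real.Gamma (1 - γ) * ‖w‖ ^ 2 : ℝ) : ℂ) * z := by
      have : starRingEnd ℂ w * w = ((‖w‖ ^ 2 : ℝ) : ℂ) := by
        rw [mul_comm, Complex.mul_conj, Complex.normSq_eq_norm_sq]
      rw [Complex.ofReal_mul, ← this]; ring
    rw [h3, Complex.re_ofReal_mul]; ring
  -- The singular part `γ(1-s)^(-γ-1) q` of `G'` is nonpositive, so `G' ≤ φ`; only `φ` has to be
  -- integrable.
  have key := intervalIntegral.sub_le_integral_of_hasDeriv_right_of_le (g := G)
    (g' := fun s => (γ * (1 - s) ^ (-γ - 1)) * q s + (1 - s) ^ (-γ) * q' s) (φ := φ)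
    zero_le_one hGc (fun s hs => by
      have hp : 0 < 1 - s := sub_pos.2 hs.2
      have hd : HasDerivAt (fun s : ℝ => (1 - s) ^ (-γ)) (γ * (1 - s) ^ (-γ - 1)) s := by
        have := ((hasDerivAt_const s (1 : ℝ)).sub (hasDerivAt_id s)).rpow_const
          (p := -γ) (Or.inl hp.ne')
        refine this.congr_deriv ?_
        simp
      exact (hd.mul (hder s hs.1)).hasDerivWithinAt) hφint (fun s hs => by
      have hp : 0 < 1 - s := sub_pos.2 hs.2
      have : γ * (1 - s) ^ (-γ - 1) * q s ≤ 0 :=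
        mul_nonpos_of_nonneg_of_nonpos (by positivity) (hqle s (Ioo_subset_Icc_self hs))
      simp only [hφ]
      linarith)
  have hG1 : G 1 = 0 := by simp [hG, hq1]
  have hG0 : G 0 = q 0 := by simp [hG]
  rw [hφval, hG1, hG0, hq0] at key
  have hneg : Real.Gamma (1 - γ) * (‖w‖ ^ 2 * z.re) ≤ 0 :=
    mul_nonpos_of_nonneg_of_nonpos (Real.Gamma_pos_of_pos (sub_pos.2 h1)).le
      (mul_nonpos_of_nonneg_of_nonpos (by positivity) hz)
  have hre := Complex.re_le_norm w
  -- `key` now reads `‖w‖² ≤ Re w` up to a nonpositive term, and `Re w ≤ ‖w‖`.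
  nlinarith [norm_nonneg w]

lemma mittagLeffler_one_one (z : ℂ) : mittagLeffler 1 1 z = Complex.exp z := by
  rw [Complex.exp_eq_exp_ℂ, NormedSpace.exp_eq_tsum_div]
  simp [mittagLeffler, Complex.Gamma_nat_eq_factorial]

/-- `|E_{γ,1}| ≤ 1` on the closed left half-plane for `0 < γ ≤ 1`. -/
lemma norm_mittagLeffler_one_le {γ : ℝ} (h0 : 0 < γ) (h1 : γ ≤ 1) {z : ℂ} (hz : z.re ≤ 0) :
    ‖mittagLeffler γ 1 z‖ ≤ 1 := by
  rcases h1.lt_or_eq with h1 | rfl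
  · have hc : Continuous fun τ : ℝ => ‖mittagLeffler γ 1 (z * τ)‖ := by
      have := continuous_mittagLeffler h0 one_pos
      rw [Complex.ofReal_one] at this
      exact (this.comp (by fun_prop)).norm
    -- Replacing `z` by the point `zσ` where the modulus is largest on the segment `[0,z]` puts the
    -- maximum at the endpoint of the shorter segment.
    obtain ⟨σ, hσ, hmax⟩ := isCompact_Icc.exists_isMaxOn
      (nonempty_Icc.2 (zero_le_one (α := ℝ))) hc.continuousOn
    have hle : ‖mittagLeffler γ 1 z‖ ≤ ‖mittagLeffler γ 1 (z * σ)‖ := by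
      simpa using hmax (right_mem_Icc.2 (zero_le_one (α := ℝ)))
    refine hle.trans (norm_mittagLeffler_one_le_of_forall_segment h0 h1 ?_ fun τ hτ => ?_)
    · rw [mul_comm, Complex.re_ofReal_mul]
      exact mul_nonpos_of_nonneg_of_nonpos hσ.1 hz
    · rw [mul_assoc, ← Complex.ofReal_mul]
      exact hmax ⟨mul_nonneg hσ.1 hτ.1, mul_le_one₀ hσ.2 hτ.1 hτ.2⟩
  · rw [Complex.ofReal_one, mittagLeffler_one_one, Complex.norm_exp]
    exact Real.exp_le_one_iff.2 hz

/-- Averaging over `z` and `-z` cancels the odd powers. With `z = i√x` the square is `-x`, while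
`±z` stay in the closed left half-plane. -/
lemma mittagLeffler_two_mul_sq {a b : ℝ} (ha : 0 < a) (hb : 0 < b) (z : ℂ) :
    mittagLeffler (2 * a : ℝ) b (z ^ 2) =
      (mittagLeffler a b z + mittagLeffler a b (-z)) / 2 := by
  have h := ((hasSum_mittagLeffler ha hb z).add (hasSum_mittagLeffler ha hb (-z))).div_const 2
  have h2 := hasSum_mittagLeffler (mul_pos two_pos ha) hb (z ^ 2)
  have hinj : Function.Injective fun n : ℕ => 2 * n := mul_right_injective₀ two_ne_zero
  refine h2.unique ?_
  rw [← hinj.hasSum_iff] at h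
  · refine h.congr_fun fun n => ?_
    have : Even (2 * n) := even_two_mul n
    simp only [Function.comp_apply, this.neg_pow, add_self_div_two]
    rw [pow_mul]
    push_cast
    ring_nf
  · intro n hn
    have hodd : Odd n := by
      rw [← Nat.not_even_iff_odd]
      rintro ⟨k, rfl⟩
      exact hn ⟨k, two_mul k⟩
    rw [hodd.neg_pow]
    ring

lemma norm_mittagLeffler_one_neg_le {β : ℝ} (h0 : 0 < β) (h2 : β ≤ 2)
    {x : ℝ} (hx : 0 ≤ x) : ‖mittagLeffler β 1 ((-x : ℝ) : ℂ)‖ ≤ 1 := by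
  rcases le_or_gt β 1 with h1 | h1
  · exact norm_mittagLeffler_one_le h0 h1 (by simpa)
  · have h := mittagLeffler_two_mul_sq (half_pos h0) one_pos (Complex.I * (√x : ℝ))
    have hsq : (Complex.I * (√x : ℝ)) ^ 2 = ((-x : ℝ) : ℂ) := by
      rw [mul_pow, Complex.I_sq, ← Complex.ofReal_pow, Real.sq_sqrt hx]; simp
    rw [hsq, show 2 * (β / 2) = β by ring, Complex.ofReal_one] at h
    rw [h, norm_div, Complex.norm_two, div_le_one two_pos]
    refine (norm_add_le _ _).trans ?_
    have e1 : ‖mittagLeffler (β / 2 : ℝ) 1 (Complex.I * (√x : ℝ))‖ ≤ 1 :=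
      norm_mittagLeffler_one_le (half_pos h0) (by linarith) (by simp)
    have e2 : ‖mittagLeffler (β / 2 : ℝ) 1 (-(Complex.I * (√x : ℝ)))‖ ≤ 1 :=
      norm_mittagLeffler_one_le (half_pos h0) (by linarith) (by simp)
    linarith

/-- `E_{β,2}(-x)` is the mean over `s ∈ (0,1)` of `E_{β,1}(-x s^β)`. -/
lemma norm_mittagLeffler_two_neg_le {β : ℝ} (h0 : 0 < β) (h2 : β ≤ 2) {x : ℝ} (hx : 0 ≤ x) :
    ‖mittagLeffler β 2 ((-x : ℝ) : ℂ)‖ ≤ 1 := by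
  have h := setIntegral_rpow_mul_mittagLeffler h0 one_pos one_pos one_pos ((-x : ℝ) : ℂ)
  have h11 : (((1 : ℝ) + 1 : ℝ) : ℂ) = 2 := by norm_num
  simp only [sub_self, Real.rpow_zero, Complex.ofReal_one, one_mul, Real.Gamma_one, Real.one_rpow,
    mul_one, h11] at h
  rw [← h]
  have := norm_setIntegral_le_of_norm_le_const (μ := volume) (s := Ioo (0 : ℝ) 1) (C := 1)
    (f := fun s : ℝ => mittagLeffler β 1 (((-x : ℝ) : ℂ) * ((s ^ β : ℝ) : ℂ))) (by simp)
    (fun s hs => by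
      rw [← Complex.ofReal_mul, neg_mul]
      exact norm_mittagLeffler_one_neg_le h0 h2 (mul_nonneg hx (Real.rpow_nonneg hs.1.le _)))
  simpa using this

lemma exists_norm_mittagLeffler_self_neg_le {β : ℝ} (h0 : 0 < β) (h2 : β ≤ 2) :
    ∃ C : ℝ, ∀ x : ℝ, 0 ≤ x → ‖mittagLeffler β β ((-x : ℝ) : ℂ)‖ ≤ C := by
  rcases le_or_gt β 1 with h1 | h1
  · have hc : Continuous fun x : ℝ => ‖mittagLeffler β β ((-x : ℝ) : ℂ)‖ :=
      ((continuous_mittagLeffler h0 h0).comp (by fun_prop)).norm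
    obtain ⟨M, hM⟩ := (isCompact_Icc (a := (0 : ℝ)) (b := 1)).bddAbove_image hc.continuousOn
    refine ⟨max M 1, fun x hx => ?_⟩
    rcases le_or_gt x 1 with hx1 | hx1
    · exact le_max_of_le_left (hM ⟨x, ⟨hx, hx1⟩, rfl⟩)
    · refine le_max_of_le_right ?_
      have hd := differentiable_mittagLeffler h0 one_pos
      rw [Complex.ofReal_one] at hd
      -- The circle of radius `x` about `-x` lies in the closed left half-plane, so Cauchy's
      -- estimate bounds the derivative by `1/x`.
      have := Complex.norm_deriv_le_of_forall_mem_sphere_norm_le (f := mittagLeffler β 1)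
        (c := ((-x : ℝ) : ℂ)) (C := 1) (one_pos.trans hx1) hd.diffContOnCl fun w hw => by
          refine norm_mittagLeffler_one_le h0 h1 ?_
          rw [mem_sphere_iff_norm] at hw
          have := Complex.re_le_norm (w - ((-x : ℝ) : ℂ))
          rw [hw, Complex.sub_re, Complex.ofReal_re] at this
          linarith
      rw [← mul_deriv_mittagLeffler_one h0, norm_mul, Complex.norm_real,
        Real.norm_of_nonneg h0.le]
      have h3 : 1 / x ≤ 1 := by rw [div_le_one (by linarith)]; exact hx1.le
      exact mul_le_one₀ h1 (norm_nonneg _) (this.trans h3)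
  · have hb : 0 < β - 1 := sub_pos.2 h1
    -- For `β > 1`, `E_{β,β}` is a fractional integral of order `β-1` of `E_{β,1}`, which is bounded
    -- by `1`.
    refine ⟨(Real.Gamma (β - 1))⁻¹ * ∫ s in Ioo (0 : ℝ) 1, s ^ ((1 : ℝ) - 1) * (1 - s) ^ (β - 1 - 1),
      fun x hx => ?_⟩
    have h := setIntegral_rpow_mul_mittagLeffler h0 one_pos hb one_pos ((-x : ℝ) : ℂ)
    have hG := Real.Gamma_pos_of_pos hb
    rw [le_inv_mul_iff₀ hG]
    rw [show 1 + (β - 1) = β by ring] at h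
    simp only [Real.one_rpow, mul_one, Complex.ofReal_one] at h
    have h4 := congrArg norm h
    rw [norm_mul, Complex.norm_real, Real.norm_of_nonneg hG.le] at h4
    rw [← h4]
    refine norm_integral_le_of_norm_le (integrableOn_beta_scaled one_pos hb one_pos) ?_
    filter_upwards [ae_restrict_mem measurableSet_Ioo] with s hs
    have hs1 : 0 < 1 - s := sub_pos.2 hs.2
    rw [← Complex.ofReal_mul, neg_mul, norm_mul, norm_mul, Complex.norm_real, Complex.norm_real,
      Real.norm_of_nonneg (by positivity), sub_self, Real.rpow_zero, norm_one, one_mul, one_mul]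
    exact mul_le_of_le_one_right (by positivity)
      (norm_mittagLeffler_one_neg_le h0 h2 (mul_nonneg hx (Real.rpow_nonneg hs.1.le _)))

/-! ### Convolutions with the resolvent kernel and variation of constants -/

/-- The causal power `u ↦ u ^ (c - 1)` for `u > 0`, extended by zero. -/
noncomputable def causalPow (c u : ℝ) : ℝ := (Ioi (0 : ℝ)).indicator (fun u => u ^ (c - 1)) u

/-- The resolvent kernel `s ^ (β - 1) E_{β,β}(-l s ^ β)`. -/
noncomputable def mlKernel (β l s : ℝ) : ℂ := ((s ^ (β - 1) : ℝ) : ℂ) * mittagLeffler β β ((-(l * s ^ β) : ℝ) : ℂ)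

lemma measurable_causalPow (c : ℝ) : Measurable (causalPow c) :=
  Measurable.indicator (by fun_prop) measurableSet_Ioi

lemma causalPow_of_pos {c u : ℝ} (hu : 0 < u) : causalPow c u = u ^ (c - 1) :=
  indicator_of_mem (mem_Ioi.2 hu) _

lemma causalPow_of_nonpos {c u : ℝ} (hu : u ≤ 0) : causalPow c u = 0 :=
  indicator_of_notMem (notMem_Ioi.2 hu) _

lemma causalPow_nonneg (c u : ℝ) : 0 ≤ causalPow c u := by
  rcases le_or_gt u 0 with h | h
  · rw [causalPow_of_nonpos h]
  · rw [causalPow_of_pos h]; positivity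

lemma continuous_mittagLeffler_neg_mul_rpow {β : ℝ} (hβ : 0 < β) {b : ℝ} (hb : 0 < b) (l : ℝ) :
    Continuous fun s : ℝ => mittagLeffler β b ((-(l * s ^ β) : ℝ) : ℂ) :=
  (continuous_mittagLeffler hβ hb).comp (Complex.continuous_ofReal.comp
    (continuous_const.mul (Real.continuous_rpow_const hβ.le)).neg)

lemma measurable_mlKernel {β : ℝ} (hβ : 0 < β) (l : ℝ) : Measurable (mlKernel β l) :=
  Measurable.mul (by fun_prop) (continuous_mittagLeffler_neg_mul_rpow hβ hβ l).measurable

/-- Extension by zero lets every convolution run over the fixed interval `(0,T)`, as Fubini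
requires. Reflecting `v = T - s` recovers the true range `(0, T-τ)`. Values in `E` cover both the
kernel and its norm. -/
lemma indicator_mul_causalPow {E : Type*} [NormedAddCommGroup E] [NormedSpace ℝ E] (g : ℝ → E)
    (c : ℝ) {τ T : ℝ} (hτ : 0 ≤ τ) :
    ((Ioo 0 T).indicator fun s => causalPow c (s - τ) • g (T - s)) =
      fun s => (Ioo 0 (T - τ)).indicator (fun v => (T - τ - v) ^ (c - 1) • g v) (T - s) := by
  funext s
  by_cases h : T - s ∈ Ioo 0 (T - τ)
  · have h1 : 0 < s - τ := by linarith [h.2]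
    rw [indicator_of_mem h, indicator_of_mem (show s ∈ Ioo 0 T from ⟨by linarith, by linarith [h.1]⟩),
      causalPow_of_pos h1, show T - τ - (T - s) = s - τ by ring]
  · rw [indicator_of_notMem h]
    by_cases h2 : s ∈ Ioo 0 T
    · rw [indicator_of_mem h2, causalPow_of_nonpos, zero_smul]
      by_contra h3
      exact h ⟨by linarith [h2.2], by linarith⟩
    · rw [indicator_of_notMem h2]

lemma setIntegral_causalPow_smul {E : Type*} [NormedAddCommGroup E] [NormedSpace ℝ E] (g : ℝ → E)
    (c : ℝ) {τ T : ℝ} (hτ : 0 ≤ τ) :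
    ∫ s in Ioo 0 T, causalPow c (s - τ) • g (T - s) =
      ∫ v in Ioo 0 (T - τ), (T - τ - v) ^ (c - 1) • g v := by
  rw [← integral_indicator measurableSet_Ioo, indicator_mul_causalPow g c hτ,
    integral_sub_left_eq_self, integral_indicator measurableSet_Ioo]

lemma integrableOn_causalPow_smul {E : Type*} [NormedAddCommGroup E] [NormedSpace ℝ E]
    {g : ℝ → E} {c τ T : ℝ} (hτ : 0 ≤ τ)
    (h : IntegrableOn (fun v => (T - τ - v) ^ (c - 1) • g v) (Ioo 0 (T - τ))) :
    IntegrableOn (fun s => causalPow c (s - τ) • g (T - s)) (Ioo 0 T) := by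
  rw [← integrable_indicator_iff measurableSet_Ioo] at h ⊢
  rw [indicator_mul_causalPow g c hτ]
  exact h.comp_sub_left T

lemma integrableOn_rpow_smul_mlKernel {β c y : ℝ} (hβ : 0 < β) (hc : 0 < c) (hy : 0 < y) (l : ℝ) :
    IntegrableOn (fun v : ℝ => (y - v) ^ (c - 1) • mlKernel β l v) (Ioo 0 y) := by
  refine (integrableOn_rpow_mul_mittagLeffler hβ hβ hc hy ((-l : ℝ) : ℂ)).congr
    (ae_of_all _ fun s => ?_)
  simp only
  rw [mlKernel, Complex.real_smul, ← Complex.ofReal_mul, neg_mul]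

lemma setIntegral_rpow_smul_mlKernel {β c y : ℝ} (hβ : 0 < β) (hc : 0 < c) (hy : 0 < y) (l : ℝ) :
    ∫ v in Ioo 0 y, (y - v) ^ (c - 1) • mlKernel β l v =
      ((Real.Gamma c * y ^ (β + c - 1) : ℝ) : ℂ) *
        mittagLeffler β (β + c : ℝ) ((-(l * y ^ β) : ℝ) : ℂ) := by
  have := setIntegral_rpow_mul_mittagLeffler hβ hβ hc hy ((-l : ℝ) : ℂ)
  rw [← Complex.ofReal_mul, neg_mul] at this
  rw [← this]
  refine setIntegral_congr_fun measurableSet_Ioo fun s _ => ?_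
  rw [mlKernel, Complex.real_smul, ← Complex.ofReal_mul, neg_mul]

lemma norm_mlKernel_le {β l C : ℝ} (hl : 0 ≤ l)
    (hC : ∀ x : ℝ, 0 ≤ x → ‖mittagLeffler β β ((-x : ℝ) : ℂ)‖ ≤ C) {s : ℝ} (hs : 0 ≤ s) :
    ‖mlKernel β l s‖ ≤ C * s ^ (β - 1) := by
  rw [mlKernel, norm_mul, Complex.norm_real, Real.norm_of_nonneg (by positivity), mul_comm]
  exact mul_le_mul_of_nonneg_right (hC _ (by positivity)) (by positivity)

/-- For fixed `τ`, the boundedness of `E_{β,β}` reduces the integral in `s` to a Beta integral of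
size `(T-τ)^(β+c-1)`. The condition `β + c ≥ 1` keeps this bounded in `τ`. -/
lemma integrable_mlKernel_mul_causalPow {β c T l : ℝ} (hβ : 0 < β) (hβ2 : β ≤ 2) (hc : 0 < c)
    (hβc : 1 ≤ β + c) (hl : 0 ≤ l) {W : ℝ → ℂ} (hW : IntegrableOn W (Ioo 0 T)) :
    Integrable (fun p : ℝ × ℝ => mlKernel β l (T - p.1) * ((causalPow c (p.1 - p.2) : ℂ) * W p.2))
      ((volume.restrict (Ioo 0 T)).prod (volume.restrict (Ioo 0 T))) := by
  obtain ⟨C, hC⟩ := exists_norm_mittagLeffler_self_neg_le hβ hβ2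
  have hC0 : 0 ≤ C := (norm_nonneg _).trans (hC 0 le_rfl)
  have hmeas : AEStronglyMeasurable
      (fun p : ℝ × ℝ => mlKernel β l (T - p.1) * ((causalPow c (p.1 - p.2) : ℂ) * W p.2))
      ((volume.restrict (Ioo 0 T)).prod (volume.restrict (Ioo 0 T))) := by
    refine AEStronglyMeasurable.mul ?_ (AEStronglyMeasurable.mul ?_ hW.aestronglyMeasurable.comp_snd)
    · exact ((measurable_mlKernel hβ l).comp (by fun_prop)).aestronglyMeasurable
    · exact (Complex.measurable_ofReal.comp
        ((measurable_causalPow c).comp (by fun_prop))).aestronglyMeasurable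
  rw [integrable_prod_iff' hmeas]
  refine ⟨?_, ?_⟩
  · filter_upwards [ae_restrict_mem measurableSet_Ioo] with τ hτ
    have := integrableOn_causalPow_smul hτ.1.le
      (integrableOn_rpow_smul_mlKernel hβ hc (sub_pos.2 hτ.2) l)
    refine (this.mul_const (W τ)).congr (ae_of_all _ fun s => ?_)
    simp only [Complex.real_smul]
    ring
  · set K : ℝ := Real.Gamma β * Real.Gamma c / Real.Gamma (β + c) with hK
    have hK0 : 0 ≤ K := by
      have := Real.Gamma_pos_of_pos hβ
      have := Real.Gamma_pos_of_pos hc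
      have := Real.Gamma_pos_of_pos (add_pos hβ hc)
      positivity
    refine Integrable.mono' (hW.norm.const_mul (C * (T ^ (β + c - 1) * K)))
      (hmeas.norm.prod_swap.integral_prod_right') ?_
    filter_upwards [ae_restrict_mem measurableSet_Ioo] with τ hτ
    have hy : 0 < T - τ := sub_pos.2 hτ.2
    rw [Real.norm_of_nonneg (integral_nonneg fun _ => norm_nonneg _)]
    have e1 : ∀ s, ‖mlKernel β l (T - s) * ((causalPow c (s - τ) : ℂ) * W τ)‖ =
        (causalPow c (s - τ) • ‖mlKernel β l (T - s)‖) * ‖W τ‖ := fun s => by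
      rw [norm_mul, norm_mul, Complex.norm_real, Real.norm_of_nonneg (causalPow_nonneg _ _),
        smul_eq_mul]
      ring
    simp_rw [e1]
    rw [integral_mul_const, setIntegral_causalPow_smul (fun v => ‖mlKernel β l v‖) c hτ.1.le]
    refine mul_le_mul_of_nonneg_right ?_ (norm_nonneg _)
    have hint : IntegrableOn (fun v => ‖(T - τ - v) ^ (c - 1) • mlKernel β l v‖) (Ioo 0 (T - τ)) :=
      (integrableOn_rpow_smul_mlKernel hβ hc hy l).norm
    calc ∫ v in Ioo 0 (T - τ), (T - τ - v) ^ (c - 1) • ‖mlKernel β l v‖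
        ≤ ∫ v in Ioo 0 (T - τ), C * (v ^ (β - 1) * (T - τ - v) ^ (c - 1)) := by
          refine setIntegral_mono_on (hint.congr_fun (fun v hv => ?_) measurableSet_Ioo)
            ((integrableOn_beta_scaled hβ hc hy).const_mul C) measurableSet_Ioo fun v hv => ?_
          · have : 0 < T - τ - v := sub_pos.2 hv.2
            simp only
            rw [norm_smul, Real.norm_of_nonneg (by positivity), smul_eq_mul]
          · have h1 : 0 < T - τ - v := sub_pos.2 hv.2
            have h2 := norm_mlKernel_le hl hC hv.1.le
            rw [smul_eq_mul, ← mul_assoc, mul_comm]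
            gcongr
      _ = C * ((T - τ) ^ (β + c - 1) * K) := by
          rw [integral_const_mul, setIntegral_beta_scaled hβ hc hy]
      _ ≤ C * (T ^ (β + c - 1) * K) := by
          have : (T - τ) ^ (β + c - 1) ≤ T ^ (β + c - 1) :=
            Real.rpow_le_rpow hy.le (by linarith [hτ.1]) (by linarith)
          gcongr

lemma integrableOn_mlKernel_mul_integral {β c T l : ℝ} (hβ : 0 < β) (hβ2 : β ≤ 2) (hc : 0 < c)
    (hβc : 1 ≤ β + c) (hl : 0 ≤ l) {W : ℝ → ℂ} (hW : IntegrableOn W (Ioo 0 T)) :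
    IntegrableOn (fun s => mlKernel β l (T - s) *
      ∫ τ in Ioo 0 T, (causalPow c (s - τ) : ℂ) * W τ) (Ioo 0 T) := by
  have := (integrable_mlKernel_mul_causalPow hβ hβ2 hc hβc hl hW).integral_prod_left
  simp only [integral_const_mul] at this
  exact this

lemma setIntegral_mlKernel_mul_integral {β c T l : ℝ} (hβ : 0 < β) (hβ2 : β ≤ 2) (hc : 0 < c)
    (hβc : 1 ≤ β + c) (hl : 0 ≤ l) {W : ℝ → ℂ} (hW : IntegrableOn W (Ioo 0 T)) :
    ∫ s in Ioo 0 T, mlKernel β l (T - s) * ∫ τ in Ioo 0 T, (causalPow c (s - τ) : ℂ) * W τ =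
      ∫ τ in Ioo 0 T, ((Real.Gamma c * (T - τ) ^ (β + c - 1) : ℝ) : ℂ) *
        mittagLeffler β (β + c : ℝ) ((-(l * (T - τ) ^ β) : ℝ) : ℂ) * W τ := by
  have := integral_integral_swap (f := fun s τ =>
    mlKernel β l (T - s) * ((causalPow c (s - τ) : ℂ) * W τ)) (integrable_mlKernel_mul_causalPow hβ hβ2 hc hβc hl hW)
  simp only [integral_const_mul] at this
  rw [this]
  refine setIntegral_congr_fun measurableSet_Ioo fun τ hτ => ?_
  rw [← setIntegral_rpow_smul_mlKernel hβ hc (sub_pos.2 hτ.2) l,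
    ← setIntegral_causalPow_smul _ c hτ.1.le, ← integral_mul_const]
  refine integral_congr_ae (ae_of_all _ fun s => ?_)
  simp only [Complex.real_smul]
  ring

lemma integrableOn_mlKernel_mul_rpow {β c T : ℝ} (hβ : 0 < β) (hc : 0 < c) (hT : 0 < T) (l : ℝ) :
    IntegrableOn (fun s => mlKernel β l (T - s) * ((s ^ (c - 1) : ℝ) : ℂ)) (Ioo 0 T) := by
  have h := integrableOn_causalPow_smul (g := mlKernel β l) (c := c) (T := T) le_rfl (by
    rw [sub_zero]; exact integrableOn_rpow_smul_mlKernel hβ hc hT l)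
  refine h.congr_fun (fun s hs => ?_) measurableSet_Ioo
  simp only
  rw [sub_zero, causalPow_of_pos hs.1, Complex.real_smul, mul_comm]

lemma setIntegral_mlKernel_mul_rpow {β c T : ℝ} (hβ : 0 < β) (hc : 0 < c) (hT : 0 < T) (l : ℝ) :
    ∫ s in Ioo 0 T, mlKernel β l (T - s) * ((s ^ (c - 1) : ℝ) : ℂ) =
      ((Real.Gamma c * T ^ (β + c - 1) : ℝ) : ℂ) *
        mittagLeffler β (β + c : ℝ) ((-(l * T ^ β) : ℝ) : ℂ) := by
  rw [← setIntegral_rpow_smul_mlKernel hβ hc hT l]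
  have h := setIntegral_causalPow_smul (mlKernel β l) c (T := T) le_rfl
  rw [sub_zero] at h
  rw [← h]
  refine setIntegral_congr_fun measurableSet_Ioo fun s hs => ?_
  rw [sub_zero, causalPow_of_pos hs.1, Complex.real_smul, mul_comm]

lemma IntegrableOn.continuous_mul_Ioo {W g : ℝ → ℂ} {T : ℝ} (hW : IntegrableOn W (Ioo 0 T))
    (hg : Continuous g) : IntegrableOn (fun s => g s * W s) (Ioo 0 T) := by
  have hW' : IntegrableOn W (Icc 0 T) := (integrableOn_Icc_iff_integrableOn_Ioo).2 hW
  exact (hW'.continuousOn_mul hg.continuousOn isCompact_Icc).mono_set Ioo_subset_Icc_self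

lemma continuous_rpow_mul_mittagLeffler {β b c : ℝ} (hβ : 0 < β) (hb : 0 < b) (hc : 1 ≤ c)
    (l T : ℝ) : Continuous fun τ : ℝ => (((T - τ) ^ (c - 1) : ℝ) : ℂ) *
      mittagLeffler β b ((-(l * (T - τ) ^ β) : ℝ) : ℂ) :=
  (Complex.continuous_ofReal.comp ((continuous_const.sub continuous_id).rpow_const
    fun _ => Or.inr (sub_nonneg.2 hc))).mul
    ((continuous_mittagLeffler_neg_mul_rpow hβ hb l).comp (continuous_const.sub continuous_id))

/-- Variation of constants for the Volterra form of a fractional relaxation equation. -/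
lemma eq_mittagLeffler_of_convolution {β M T l : ℝ} (hβ : 0 < β) (hβ2 : β ≤ 2) (hM : 1 ≤ M)
    (hT : 0 < T) (hl : 0 ≤ l) {W U Φ V : ℝ → ℂ} {a b : ℂ} (hW : IntegrableOn W (Ioo 0 T))
    (hU : ∀ s ∈ Ioc 0 T, U s = a + b * s +
      1 / (Real.Gamma M : ℂ) * ∫ τ in Ioo 0 T, (causalPow M (s - τ) : ℂ) * W τ)
    (hV : IntegrableOn (fun s => mlKernel β l (T - s) * V s) (Ioo 0 T))
    (hV' : ∫ s in Ioo 0 T, mlKernel β l (T - s) * V s = ∫ τ in Ioo 0 T,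
      (((T - τ) ^ (M - 1) : ℝ) : ℂ) * mittagLeffler β M ((-(l * (T - τ) ^ β) : ℝ) : ℂ) * W τ)
    (hΦ : ∀ᵐ s ∂volume.restrict (Ioo 0 T), Φ s = l * U s + V s) :
    U T = a * mittagLeffler β 1 ((-(l * T ^ β) : ℝ) : ℂ) +
      b * (T * mittagLeffler β 2 ((-(l * T ^ β) : ℝ) : ℂ)) +
      ∫ s in Ioo 0 T, mlKernel β l (T - s) * Φ s := by
  have hM0 : 0 < M := by linarith
  have hΓ : ((Real.Gamma M : ℝ) : ℂ) ≠ 0 := by exact_mod_cast (Real.Gamma_pos_of_pos hM0).ne'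
  have i1 := (integrableOn_mlKernel_mul_rpow hβ one_pos hT l).const_mul (l * a)
  have i2 := (integrableOn_mlKernel_mul_rpow hβ two_pos hT l).const_mul (l * b)
  have i3 := (integrableOn_mlKernel_mul_integral hβ hβ2 hM0 (by linarith) hl hW).const_mul
    (l * (1 / (Real.Gamma M : ℂ)))
  have e : ∫ s in Ioo 0 T, mlKernel β l (T - s) * Φ s = ∫ s in Ioo 0 T,
      ((l * a) * (mlKernel β l (T - s) * ((s ^ ((1 : ℝ) - 1) : ℝ) : ℂ)) +
      (l * b) * (mlKernel β l (T - s) * ((s ^ ((2 : ℝ) - 1) : ℝ) : ℂ)) +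
      (l * (1 / (Real.Gamma M : ℂ))) * (mlKernel β l (T - s) *
        ∫ τ in Ioo 0 T, (causalPow M (s - τ) : ℂ) * W τ)) + mlKernel β l (T - s) * V s := by
    refine integral_congr_ae ?_
    filter_upwards [hΦ, ae_restrict_mem measurableSet_Ioo] with s hs hsT
    rw [hs, hU s (Ioo_subset_Ioc_self hsT), sub_self, Real.rpow_zero,
      show (2 : ℝ) - 1 = 1 by norm_num, Real.rpow_one, Complex.ofReal_one]
    ring
  rw [e, integral_add (by exact (i1.add i2).add i3) hV, integral_add (by exact i1.add i2) i3,
    integral_add i1 i2, integral_const_mul, integral_const_mul, integral_const_mul,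
    setIntegral_mlKernel_mul_rpow hβ one_pos hT, setIntegral_mlKernel_mul_rpow hβ two_pos hT,
    setIntegral_mlKernel_mul_integral hβ hβ2 hM0 (by linarith) hl hW, hV',
    hU T (right_mem_Ioc.2 hT)]
  have r1 := mittagLeffler_eq_inv_Gamma_add hβ one_pos ((-(l * T ^ β) : ℝ) : ℂ)
  have r2 := mittagLeffler_eq_inv_Gamma_add hβ two_pos ((-(l * T ^ β) : ℝ) : ℂ)
  rw [add_comm 1 β, Real.Gamma_one, Complex.ofReal_one] at r1
  rw [add_comm 2 β, Real.Gamma_two, Complex.ofReal_one, Complex.ofReal_ofNat] at r2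
  -- The `W`-terms match pointwise in `τ`: this is the recursion for `E_{β,M}` at `-l(T-τ)^β`,
  -- multiplied by `(T-τ)^(M-1)`. Likewise `r1` and `r2` recombine the terms in `a` and `b`.
  have hI : 1 / (Real.Gamma M : ℂ) * ∫ τ in Ioo 0 T, (causalPow M (T - τ) : ℂ) * W τ =
      l * (1 / (Real.Gamma M : ℂ)) * (∫ τ in Ioo 0 T,
        ((Real.Gamma M * (T - τ) ^ (β + M - 1) : ℝ) : ℂ) *
          mittagLeffler β (β + M : ℝ) ((-(l * (T - τ) ^ β) : ℝ) : ℂ) * W τ) +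
      ∫ τ in Ioo 0 T, (((T - τ) ^ (M - 1) : ℝ) : ℂ) *
        mittagLeffler β M ((-(l * (T - τ) ^ β) : ℝ) : ℂ) * W τ := by
    have j1 := (IntegrableOn.continuous_mul_Ioo hW (continuous_rpow_mul_mittagLeffler hβ
      (add_pos hβ hM0) (by linarith : 1 ≤ β + M) l T)).const_mul (Real.Gamma M : ℂ)
    have j1' : IntegrableOn (fun τ => ((Real.Gamma M * (T - τ) ^ (β + M - 1) : ℝ) : ℂ) *
          mittagLeffler β (β + M : ℝ) ((-(l * (T - τ) ^ β) : ℝ) : ℂ) * W τ) (Ioo 0 T) :=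
      j1.congr (ae_of_all _ fun τ => by push_cast; ring)
    have j2 := IntegrableOn.continuous_mul_Ioo hW (continuous_rpow_mul_mittagLeffler hβ hM0 hM l T)
    rw [← integral_const_mul, ← integral_const_mul, ← integral_add (j1'.const_mul _) j2]
    refine setIntegral_congr_fun measurableSet_Ioo fun τ hτ => ?_
    have hy : 0 < T - τ := sub_pos.2 hτ.2
    have r := mittagLeffler_eq_inv_Gamma_add hβ hM0 ((-(l * (T - τ) ^ β) : ℝ) : ℂ)
    rw [add_comm M β] at r
    rw [causalPow_of_pos hy, r, show β + M - 1 = β + (M - 1) by ring, Real.rpow_add hy]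
    push_cast
    field_simp
    ring
  rw [hI, r1, r2, show β + 1 - 1 = β by ring, show β + 2 - 1 = β + 1 by ring, Real.rpow_add hT,
    Real.rpow_one, Real.Gamma_one, Real.Gamma_two]
  push_cast
  ring

/-! ### Taylor's formula in time -/

lemma setIntegral_causalPow_mul (D : ℝ → ℂ) (c : ℝ) {s T : ℝ} (hs : s ∈ Ioc 0 T) :
    ∫ τ in Ioo 0 T, (causalPow c (s - τ) : ℂ) * D τ =
      ∫ τ in (0 : ℝ)..s, (((s - τ) ^ (c - 1) : ℝ) : ℂ) * D τ := by
  rw [intervalIntegral.integral_of_le hs.1.le, integral_Ioc_eq_integral_Ioo,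
    ← integral_indicator measurableSet_Ioo, ← integral_indicator measurableSet_Ioo]
  congr 1
  funext τ
  by_cases h : τ ∈ Ioo 0 s
  · rw [indicator_of_mem h, indicator_of_mem (show τ ∈ Ioo 0 T from ⟨h.1, h.2.trans_le hs.2⟩),
      causalPow_of_pos (sub_pos.2 h.2)]
  · rw [indicator_of_notMem h]
    by_cases h2 : τ ∈ Ioo 0 T
    · rw [indicator_of_mem h2, causalPow_of_nonpos, Complex.ofReal_zero, zero_mul]
      by_contra h3
      exact h ⟨h2.1, by linarith⟩
    · rw [indicator_of_notMem h2]

lemma hasDerivAt_deriv_of_contDiffOn {u : ℝ → ℂ} {n : WithTop ℕ∞} (hn : 1 ≤ n)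
    (hu : ContDiffOn ℝ n u (Ioi 0)) {s : ℝ} (hs : 0 < s) : HasDerivAt u (deriv u s) s :=
  ((hu.differentiableOn (by positivity)).differentiableAt (Ioi_mem_nhds hs)).hasDerivAt

lemma eq_add_integral_deriv {u : ℝ → ℂ} (hc : ContinuousOn u (Ici 0))
    (hu : ContDiffOn ℝ 1 u (Ioi 0)) {s : ℝ} (hs : 0 ≤ s)
    (hi : IntervalIntegrable (deriv u) volume 0 s) :
    u s = u 0 + ∫ τ in (0 : ℝ)..s, deriv u τ := by
  rw [intervalIntegral.integral_eq_sub_of_hasDerivAt_of_le hs (hc.mono Icc_subset_Ici_self)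
    (fun x hx => hasDerivAt_deriv_of_contDiffOn le_rfl hu hx.1) hi]
  ring

/-- Nothing is known about `w` at `0`, so the constant, its limit from the right, is written through
the endpoint `T`. -/
lemma deriv_eq_add_integral_deriv {w : ℝ → ℂ} (hw : ContDiffOn ℝ 1 w (Ioi 0)) {T : ℝ} (hT : 0 < T)
    (hi : IntervalIntegrable (deriv w) volume 0 T) {s : ℝ} (hs : s ∈ Ioc 0 T) :
    w s = (w T - ∫ τ in (0 : ℝ)..T, deriv w τ) + ∫ τ in (0 : ℝ)..s, deriv w τ := by
  have h1 : IntervalIntegrable (deriv w) volume 0 s :=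
    hi.mono_set (uIcc_subset_uIcc_left (by rw [uIcc_of_le hT.le]; exact Ioc_subset_Icc_self hs))
  have h2 : IntervalIntegrable (deriv w) volume s T := h1.symm.trans hi
  have h3 := intervalIntegral.integral_eq_sub_of_hasDerivAt_of_le (f := w) hs.2
    (hw.continuousOn.mono fun x hx => hs.1.trans_le hx.1)
    (fun x hx => hasDerivAt_deriv_of_contDiffOn le_rfl hw (hs.1.trans hx.1)) h2
  rw [← intervalIntegral.integral_add_adjacent_intervals h1 h2, h3]
  ring

lemma eq_add_mul_add_integral_deriv_deriv {u : ℝ → ℂ} {v : ℂ} (hc : ContinuousOn u (Ici 0))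
    (hu : ContDiffOn ℝ 2 u (Ioi 0)) (hv : HasDerivWithinAt u v (Ici 0) 0) {s : ℝ} (hs : 0 < s)
    (hi : IntervalIntegrable (deriv (deriv u)) volume 0 s) :
    u s = u 0 + v * s + ∫ τ in (0 : ℝ)..s, ((s - τ : ℝ) : ℂ) * deriv (deriv u) τ := by
  have hw : ContDiffOn ℝ 1 (deriv u) (Ioi 0) :=
    hu.deriv_of_isOpen isOpen_Ioi (by norm_num)
  set c : ℂ := deriv u s - ∫ τ in (0 : ℝ)..s, deriv (deriv u) τ with hcdef
  set p : ℝ → ℂ := fun σ => c + ∫ τ in (0 : ℝ)..σ, deriv (deriv u) τ with hp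
  have hwp : ∀ σ ∈ Ioc 0 s, deriv u σ = p σ := fun σ hσ =>
    deriv_eq_add_integral_deriv hw hs hi hσ
  have hpc : ContinuousOn p (Icc 0 s) := by
    have := intervalIntegral.continuousOn_primitive_interval
      (show IntegrableOn (deriv (deriv u)) (uIcc 0 s) by
        rw [uIcc_of_le hs.le]; exact (intervalIntegrable_iff_integrableOn_Icc_of_le hs.le).1 hi)
    rw [uIcc_of_le hs.le] at this
    exact continuousOn_const.add this
  have hp0 : p 0 = c := by simp [hp]
  have hlim : Filter.Tendsto (fun x => deriv u x) (nhdsWithin 0 (Ioi 0)) (nhds c) := by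
    have h1 : Filter.Tendsto p (nhdsWithin 0 (Ioc 0 s)) (nhds c) := by
      have := (hpc 0 (left_mem_Icc.2 hs.le)).mono_left (nhdsWithin_mono 0 Ioc_subset_Icc_self)
      rwa [hp0] at this
    rw [nhdsWithin_Ioc_eq_nhdsGT hs] at h1
    refine h1.congr' ?_
    filter_upwards [Ioc_mem_nhdsGT hs] with σ hσ using (hwp σ hσ).symm
  -- The limit of `u'` at `0+` is also the one-sided derivative of `u` there, hence equals the
  -- prescribed velocity.
  have hcv : c = v := by
    have h1 := hasDerivWithinAt_Ici_of_tendsto_deriv (s := Ioi 0) (a := 0) (f := u)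
      (hu.differentiableOn (by norm_num))
      ((hc 0 self_mem_Ici).mono Ioi_subset_Ici_self) self_mem_nhdsWithin hlim
    exact UniqueDiffWithinAt.eq_deriv _ (uniqueDiffOn_Ici 0 0 self_mem_Ici) h1 hv
  -- Integration by parts through the explicit primitive `u + (s-σ)p`, with `p` the continuous
  -- extension of `u'` to `0`.
  have hder : ∀ σ ∈ Ioo 0 s, HasDerivAt (fun σ => u σ + ((s - σ : ℝ) : ℂ) * p σ)
      (((s - σ : ℝ) : ℂ) * deriv (deriv u) σ) σ := fun σ hσ => by
    have h1 : HasDerivAt u (p σ) σ := by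
      rw [← hwp σ (Ioo_subset_Ioc_self hσ)]
      exact hasDerivAt_deriv_of_contDiffOn (by norm_num) hu hσ.1
    have h2 : HasDerivAt p (deriv (deriv u) σ) σ := by
      refine (hasDerivAt_deriv_of_contDiffOn le_rfl hw hσ.1).congr_of_eventuallyEq ?_
      filter_upwards [Ioo_mem_nhds hσ.1 hσ.2] with x hx
      exact (hwp x (Ioo_subset_Ioc_self hx)).symm
    have h3 : HasDerivAt (fun σ : ℝ => ((s - σ : ℝ) : ℂ)) (-1) σ := by
      have := ((hasDerivAt_id σ).const_sub s).ofReal_comp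
      simpa using this
    refine (h1.add (h3.mul h2)).congr_deriv ?_
    ring
  have hint : IntervalIntegrable (fun σ : ℝ => ((s - σ : ℝ) : ℂ) * deriv (deriv u) σ)
      volume 0 s := hi.continuousOn_mul (by fun_prop)
  have key := intervalIntegral.integral_eq_sub_of_hasDerivAt_of_le hs.le
    ((hc.mono Icc_subset_Ici_self).add (ContinuousOn.mul (by fun_prop) hpc)) hder hint
  rw [key, Pi.add_apply, Pi.add_apply, Pi.mul_apply, Pi.mul_apply, hp0, hcv]
  simp
  ring

lemma natCeil_eq_one {β : ℝ} (h0 : 0 < β) (h1 : β ≤ 1) : ⌈β⌉₊ = 1 := by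
  rw [Nat.ceil_eq_iff one_ne_zero]; simpa using ⟨h0, h1⟩

lemma natCeil_eq_two {β : ℝ} (h1 : 1 < β) (h2 : β ≤ 2) : ⌈β⌉₊ = 2 := by
  rw [Nat.ceil_eq_iff two_ne_zero]; simpa using ⟨h1, h2⟩

lemma IsSolution.eq_taylor {η α β : ℝ} {φ : ℝ → ℝ → ℂ} {f g : ℝ → ℂ} {N : ℝ → ℝ → ℂ}
    (hN : IsSolution η α β φ f g N) (hβ : 0 < β) (hβ2 : β ≤ 2) (x : ℝ) {s T : ℝ}
    (hs : s ∈ Ioc 0 T) :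
    N x s = f x + (if 1 < β then g x else 0) * s + ∫ τ in Ioo 0 T,
      (causalPow ⌈β⌉₊ (s - τ) : ℂ) * iteratedDeriv ⌈β⌉₊ (N x) τ := by
  have hi := hN.intervalIntegrable_time x s hs.1
  have hd := hN.contDiff_time x
  rw [setIntegral_causalPow_mul _ _ hs, ← hN.initial_value x]
  rcases le_or_gt β 1 with h1 | h1
  · rw [natCeil_eq_one hβ h1] at hi hd ⊢
    rw [if_neg h1.not_gt]
    simp only [iteratedDeriv_one, Nat.cast_one] at hi hd ⊢
    simpa using eq_add_integral_deriv (hN.continuous_time x) hd hs.1.le hi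
  · rw [natCeil_eq_two h1 hβ2] at hi hd ⊢
    rw [if_pos h1]
    have h2 : iteratedDeriv 2 (N x) = deriv (deriv (N x)) := by
      rw [iteratedDeriv_succ, iteratedDeriv_one]
    rw [h2] at hi ⊢
    rw [eq_add_mul_add_integral_deriv_deriv (hN.continuous_time x) hd (hN.initial_velocity h1 x)
      hs.1 hi]
    norm_num

lemma caputoDeriv_eq {β : ℝ} (u : ℝ → ℂ) (hβ : β ≠ ⌈β⌉₊) {s T : ℝ} (hs : s ∈ Ioc 0 T) :
    caputoDeriv β u s = 1 / (Real.Gamma (⌈β⌉₊ - β) : ℂ) * ∫ τ in Ioo 0 T,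
      (causalPow (⌈β⌉₊ - β) (s - τ) : ℂ) * iteratedDeriv ⌈β⌉₊ u τ := by
  rw [caputoDeriv, if_neg hβ, setIntegral_causalPow_mul _ _ hs]
  push_cast
  rfl

/-! ### The Fourier transform in space -/

lemma fourierTilde_neg_two_pi_mul (h : ℝ → ℂ) (w : ℝ) :
    fourierTilde h (-(2 * Real.pi) * w) = FourierTransform.fourier h w := by
  rw [Real.fourier_real_eq_integral_exp_smul, fourierTilde]
  congr 1
  funext v
  rw [smul_eq_mul, mul_comm]
  congr 2
  push_cast
  ring

lemma eq_integral_fourierTilde {h : ℝ → ℂ} (hc : Continuous h) (hi : Integrable h)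
    (hi' : Integrable (fourierTilde h)) (x : ℝ) :
    h x = 1 / (2 * (Real.pi : ℂ)) *
      ∫ k : ℝ, fourierTilde h k * Complex.exp (-(Complex.I * k * x)) := by
  have hpi : -(2 * Real.pi) ≠ 0 := by simp [Real.pi_ne_zero]
  have h1 : Integrable (FourierTransform.fourier h) := by
    refine (hi'.comp_mul_left' hpi).congr (ae_of_all _ fun w => ?_)
    exact fourierTilde_neg_two_pi_mul h w
  have h2 := congrFun (hc.fourierInv_fourier_eq hi h1) x
  rw [Real.fourierInv_eq'] at h2
  have h3 := Measure.integral_comp_mul_left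
    (fun k : ℝ => fourierTilde h k * Complex.exp (-(Complex.I * k * x))) (-(2 * Real.pi))
  have h4 : ∫ w : ℝ, fourierTilde h (-(2 * Real.pi) * w) *
      Complex.exp (-(Complex.I * ((-(2 * Real.pi) * w : ℝ) : ℂ) * x)) = h x := by
    rw [← h2]
    congr 1
    funext w
    rw [fourierTilde_neg_two_pi_mul, smul_eq_mul, mul_comm]
    congr 2
    simp only [RCLike.inner_apply, conj_trivial]
    push_cast
    ring
  rw [h4] at h3
  rw [h3, abs_inv, abs_neg, abs_of_pos Real.two_pi_pos, Complex.real_smul]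
  push_cast
  rw [one_div]

lemma norm_cexp_I_mul (k x : ℝ) : ‖Complex.exp (Complex.I * k * x)‖ = 1 := by
  rw [mul_assoc, mul_comm, ← Complex.ofReal_mul, Complex.norm_exp_ofReal_mul_I]

lemma norm_cexp_neg_I_mul (k x : ℝ) : ‖Complex.exp (-(Complex.I * k * x))‖ = 1 := by
  rw [Complex.exp_neg, norm_inv, norm_cexp_I_mul, inv_one]

lemma integrable_mul_cexp {h : ℝ → ℂ} (hh : Integrable h) (k : ℝ) :
    Integrable fun x : ℝ => h x * Complex.exp (Complex.I * k * x) :=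
  hh.mul_bdd (c := 1) (by fun_prop) (ae_of_all _ fun x => (norm_cexp_I_mul k x).le)

lemma fourierTilde_add {h₁ h₂ : ℝ → ℂ} (i₁ : Integrable h₁) (i₂ : Integrable h₂) (k : ℝ) :
    fourierTilde (fun x => h₁ x + h₂ x) k = fourierTilde h₁ k + fourierTilde h₂ k := by
  simp only [fourierTilde, add_mul]
  exact integral_add (integrable_mul_cexp i₁ k) (integrable_mul_cexp i₂ k)

lemma fourierTilde_const_mul (c : ℂ) (h : ℝ → ℂ) (k : ℝ) :
    fourierTilde (fun x => c * h x) k = c * fourierTilde h k := by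
  simp only [fourierTilde, mul_assoc]
  exact integral_const_mul _ _

lemma integrable_mul_cexp_prod {F : ℝ × ℝ → ℂ} {ν : Measure ℝ} [SFinite ν]
    (hF : Integrable F (volume.prod ν)) (k : ℝ) :
    Integrable (fun p : ℝ × ℝ => F p * Complex.exp (Complex.I * k * p.1)) (volume.prod ν) :=
  hF.mul_bdd (c := 1) (by fun_prop) (ae_of_all _ fun p => (norm_cexp_I_mul k p.1).le)

/-- The Fourier transform in `x` commutes with integration in the parameter. -/
lemma fourierTilde_integral {F : ℝ → ℝ → ℂ} {κ : ℝ → ℂ} {ν : Measure ℝ} [SFinite ν]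
    (hF : Integrable (fun p : ℝ × ℝ => κ p.2 * F p.1 p.2) (volume.prod ν)) (k : ℝ) :
    fourierTilde (fun x => ∫ τ, κ τ * F x τ ∂ν) k =
      ∫ τ, κ τ * fourierTilde (fun x => F x τ) k ∂ν := by
  simp only [fourierTilde, ← integral_mul_const, ← integral_const_mul, ← mul_assoc]
  exact integral_integral_swap (f := fun x τ => κ τ * F x τ * Complex.exp (Complex.I * k * x))
    (integrable_mul_cexp_prod hF k)

/-- Convolution with `causalPow c` in the second variable is defined for almost every time. -/
lemma ae_integrable_causalPow_mul {c T : ℝ} (hc : 0 < c) {F : ℝ × ℝ → ℂ}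
    (hF : Integrable F (volume.prod (volume.restrict (Ioo 0 T)))) :
    ∀ᵐ s ∂volume.restrict (Ioo 0 T), Integrable
      (fun p : ℝ × ℝ => (causalPow c (s - p.2) : ℂ) * F p)
      (volume.prod (volume.restrict (Ioo 0 T))) := by
  -- For `c < 1` the weight is singular and a fixed `s` may fail. Integrating in `s` as well leaves
  -- at most `T^c/c` times `‖F‖`, and Fubini gives almost every `s`.
  suffices h : Integrable (fun q : (ℝ × ℝ) × ℝ => (causalPow c (q.2 - q.1.2) : ℂ) * F q.1)
      ((volume.prod (volume.restrict (Ioo 0 T))).prod (volume.restrict (Ioo 0 T))) from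
    h.prod_left_ae
  have hmeas : AEStronglyMeasurable
      (fun q : (ℝ × ℝ) × ℝ => (causalPow c (q.2 - q.1.2) : ℂ) * F q.1)
      ((volume.prod (volume.restrict (Ioo 0 T))).prod (volume.restrict (Ioo 0 T))) :=
    (Complex.measurable_ofReal.comp
      ((measurable_causalPow c).comp (by fun_prop))).aestronglyMeasurable.mul
      hF.aestronglyMeasurable.comp_fst
  have hmem : ∀ᵐ p : ℝ × ℝ ∂volume.prod (volume.restrict (Ioo 0 T)), p.2 ∈ Ioo 0 T :=
    Measure.quasiMeasurePreserving_snd.ae (ae_restrict_mem measurableSet_Ioo)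
  have hbeta : ∀ y : ℝ, 0 < y →
      IntegrableOn (fun v => (y - v) ^ (c - 1) • (1 : ℝ)) (Ioo 0 y) := fun y hy => by
    simpa using integrableOn_beta_scaled one_pos hc hy
  rw [integrable_prod_iff hmeas]
  refine ⟨?_, ?_⟩
  · filter_upwards [hmem] with p hp
    have := integrableOn_causalPow_smul (g := fun _ => (1 : ℝ)) hp.1.le (hbeta _ (sub_pos.2 hp.2))
    refine (Integrable.ofReal (𝕜 := ℂ) this).mul_const (F p) |>.congr (ae_of_all _ fun s => ?_)
    simp
  · set K : ℝ := Real.Gamma 1 * Real.Gamma c / Real.Gamma (1 + c) with hK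
    have hK0 : 0 ≤ K := by
      have := Real.Gamma_pos_of_pos one_pos
      have := Real.Gamma_pos_of_pos hc
      have := Real.Gamma_pos_of_pos (add_pos one_pos hc)
      positivity
    refine Integrable.mono' (hF.norm.const_mul (T ^ c * K))
      hmeas.norm.integral_prod_right' ?_
    filter_upwards [hmem] with p hp
    have hy : 0 < T - p.2 := sub_pos.2 hp.2
    rw [Real.norm_of_nonneg (integral_nonneg fun _ => norm_nonneg _)]
    have e1 : ∀ s, ‖(causalPow c (s - p.2) : ℂ) * F p‖ =
        (causalPow c (s - p.2) • (1 : ℝ)) * ‖F p‖ := fun s => by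
      rw [norm_mul, Complex.norm_real, Real.norm_of_nonneg (causalPow_nonneg _ _), smul_eq_mul,
        mul_one]
    simp_rw [e1]
    rw [integral_mul_const, setIntegral_causalPow_smul (fun _ => (1 : ℝ)) c hp.1.le]
    refine mul_le_mul_of_nonneg_right ?_ (norm_nonneg _)
    have h2 := setIntegral_beta_scaled one_pos hc hy
    simp only [sub_self, Real.rpow_zero, one_mul, add_sub_cancel_left] at h2
    simp only [smul_eq_mul, mul_one]
    rw [h2]
    have : (T - p.2) ^ c ≤ T ^ c := Real.rpow_le_rpow hy.le (by linarith [hp.1]) hc.le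
    simpa only [hK] using mul_le_mul_of_nonneg_right this hK0

/-- Here the weight is bounded by `T^(c-1)`, so every `s ≤ T` is allowed; the Taylor formula is
needed at each time, including `s = T`. -/
lemma integrable_causalPow_mul {c T : ℝ} (hc : 1 ≤ c) {F : ℝ × ℝ → ℂ}
    (hF : Integrable F (volume.prod (volume.restrict (Ioo 0 T)))) {s : ℝ} (hs : s ≤ T) :
    Integrable (fun p : ℝ × ℝ => (causalPow c (s - p.2) : ℂ) * F p)
      (volume.prod (volume.restrict (Ioo 0 T))) := by
  have hmem : ∀ᵐ p : ℝ × ℝ ∂volume.prod (volume.restrict (Ioo 0 T)), p.2 ∈ Ioo 0 T :=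
    Measure.quasiMeasurePreserving_snd.ae (ae_restrict_mem measurableSet_Ioo)
  refine hF.bdd_mul (c := T ^ (c - 1)) (Complex.measurable_ofReal.comp
      ((measurable_causalPow c).comp (by fun_prop))).aestronglyMeasurable ?_
  filter_upwards [hmem] with p hp
  rw [Complex.norm_real, Real.norm_of_nonneg (causalPow_nonneg _ _)]
  rcases le_or_gt (s - p.2) 0 with h | h
  · rw [causalPow_of_nonpos h]
    exact Real.rpow_nonneg (hp.1.trans hp.2).le _
  · rw [causalPow_of_pos h]
    exact Real.rpow_le_rpow h.le (by linarith [hp.1]) (sub_nonneg.2 hc)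

lemma integrable_fourierTilde_param {F : ℝ → ℝ → ℂ} {ν : Measure ℝ} [SFinite ν]
    (hF : Integrable (fun p : ℝ × ℝ => F p.1 p.2) (volume.prod ν)) (k : ℝ) :
    Integrable (fun τ => fourierTilde (fun x => F x τ) k) ν :=
  (integrable_mul_cexp_prod hF k).integral_prod_right

/-! ### The transformed equation and its solution -/

/-- The Fourier transform of the solution in `x`, written in Volterra form. -/
lemma IsSolution.fourierTilde_eq {η α β : ℝ} {φ : ℝ → ℝ → ℂ} {f g : ℝ → ℂ} {N : ℝ → ℝ → ℂ}
    (hN : IsSolution η α β φ f g N) (hβ : 0 < β) (hβ2 : β ≤ 2) (hf : Integrable f)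
    (hg : Integrable g) {s T : ℝ} (hs : s ∈ Ioc 0 T) (k : ℝ) :
    fourierTilde (fun x => N x s) k =
      fourierTilde f k + (if 1 < β then fourierTilde g k else 0) * s +
        ∫ τ in Ioo 0 T, (causalPow ⌈β⌉₊ (s - τ) : ℂ) *
          fourierTilde (fun x => iteratedDeriv ⌈β⌉₊ (N x) τ) k := by
  have hT : 0 < T := hs.1.trans_le hs.2
  have h1 : (1 : ℝ) ≤ ⌈β⌉₊ := by exact_mod_cast Nat.one_le_iff_ne_zero.2 (Nat.ceil_pos.2 hβ).ne'
  have hint := integrable_causalPow_mul h1 (hN.integrable_strip T hT) hs.2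
  rw [← fourierTilde_integral (κ := fun τ => (causalPow ⌈β⌉₊ (s - τ) : ℂ))
    (F := fun x τ => iteratedDeriv ⌈β⌉₊ (N x) τ) hint k]
  have hi3 := hint.integral_prod_left
  have hi2 : Integrable fun x => (s : ℂ) * (if 1 < β then g x else 0) := by
    refine Integrable.const_mul ?_ _
    split_ifs
    · exact hg
    · exact integrable_zero _ _ _
  have e : (fun x => N x s) = fun x => (f x + (s : ℂ) * (if 1 < β then g x else 0)) +
      ∫ τ in Ioo 0 T, (causalPow ⌈β⌉₊ (s - τ) : ℂ) * iteratedDeriv ⌈β⌉₊ (N x) τ := by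
    funext x
    rw [hN.eq_taylor hβ hβ2 x hs]
    ring
  have hi12 : Integrable fun x => f x + (s : ℂ) * (if 1 < β then g x else 0) := hf.add hi2
  rw [e, fourierTilde_add hi12 hi3, fourierTilde_add hf hi2, fourierTilde_const_mul]
  congr 2
  split_ifs
  · ring
  · simp [fourierTilde]

lemma IsSolution.fourierTilde_source_eq {η α β : ℝ} {φ : ℝ → ℝ → ℂ} {f g : ℝ → ℂ} {N : ℝ → ℝ → ℂ}
    (hN : IsSolution η α β φ f g N) {s : ℝ} (hs : 0 < s) (hφ : Integrable fun x => φ x s) (k : ℝ) :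
    fourierTilde (fun x => φ x s) k =
      ((η * |k| ^ α : ℝ) : ℂ) * fourierTilde (fun x => N x s) k +
        fourierTilde (fun x => caputoDeriv β (N x) s) k := by
  obtain ⟨v, hv, hv'⟩ := hN.equation s hs
  simp_rw [hv']
  rw [fourierTilde_add (hv.integrable_right.const_mul _) hφ, fourierTilde_const_mul, hv.symbol]
  push_cast
  ring

/-- The Fourier transform of the solution by variation of constants. -/
lemma IsSolution.fourierTilde_eq_mittagLeffler {η α β : ℝ} {φ : ℝ → ℝ → ℂ} {f g : ℝ → ℂ}
    {N : ℝ → ℝ → ℂ} (hN : IsSolution η α β φ f g N) (hη : 0 < η) (hβ : 0 < β) (hβ2 : β ≤ 2)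
    (hf : Integrable f) (hg : Integrable g) (hφ : ∀ t : ℝ, 0 < t → Integrable fun x => φ x t)
    {t : ℝ} (ht : 0 < t) (k : ℝ) :
    fourierTilde (fun x => N x t) k =
      fourierTilde f k * mittagLeffler β 1 ((-(η * |k| ^ α * t ^ β) : ℝ) : ℂ) +
      (if 1 < β then fourierTilde g k else 0) *
        (t * mittagLeffler β 2 ((-(η * |k| ^ α * t ^ β) : ℝ) : ℂ)) +
      ∫ s in Ioo 0 t, mlKernel β (η * |k| ^ α) (t - s) * fourierTilde (fun x => φ x s) k := by
  have hl : 0 ≤ η * |k| ^ α := by positivity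
  have h1 : (1 : ℝ) ≤ ⌈β⌉₊ := by exact_mod_cast Nat.one_le_iff_ne_zero.2 (Nat.ceil_pos.2 hβ).ne'
  have hstrip := hN.integrable_strip t ht
  have hW := integrable_fourierTilde_param (F := fun x τ => iteratedDeriv ⌈β⌉₊ (N x) τ) hstrip k
  have hU : ∀ s ∈ Ioc 0 t, fourierTilde (fun x => N x s) k = fourierTilde f k +
      (if 1 < β then fourierTilde g k else 0) * s + 1 / (Real.Gamma ⌈β⌉₊ : ℂ) *
        ∫ τ in Ioo 0 t, (causalPow ⌈β⌉₊ (s - τ) : ℂ) *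
          fourierTilde (fun x => iteratedDeriv ⌈β⌉₊ (N x) τ) k := fun s hs => by
    have hΓ : Real.Gamma ⌈β⌉₊ = 1 := by
      rcases le_or_gt β 1 with h | h
      · rw [natCeil_eq_one hβ h]; simp
      · rw [natCeil_eq_two h hβ2]; simp
    rw [hN.fourierTilde_eq hβ hβ2 hf hg hs k, hΓ]
    simp
  by_cases hm : β = ⌈β⌉₊
  · refine eq_mittagLeffler_of_convolution hβ hβ2 h1 ht hl (U := fun s => fourierTilde
      (fun x => N x s) k) hW hU
      (V := fun s => fourierTilde (fun x => iteratedDeriv ⌈β⌉₊ (N x) s) k) ?_ ?_ ?_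
    -- When `β = m ≥ 1` the kernel has no singularity, so it is continuous and `V = W` needs no
    -- further smoothing.
    · exact IntegrableOn.continuous_mul_Ioo hW
        (continuous_rpow_mul_mittagLeffler hβ hβ (hm ▸ h1) (η * |k| ^ α) t)
    · simp only [mlKernel]
      rw [← hm]
    · filter_upwards [ae_restrict_mem measurableSet_Ioo] with s hs
      rw [hN.fourierTilde_source_eq hs.1 (hφ s hs.1)]
      simp only [caputoDeriv, if_pos hm]
  · have hc : 0 < (⌈β⌉₊ : ℝ) - β := sub_pos.2 (lt_of_le_of_ne (Nat.le_ceil β) hm)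
    have hΓ : ((Real.Gamma (⌈β⌉₊ - β) : ℝ) : ℂ) ≠ 0 := by
      exact_mod_cast (Real.Gamma_pos_of_pos hc).ne'
    have hβc : β + (⌈β⌉₊ - β) = ⌈β⌉₊ := by ring
    refine eq_mittagLeffler_of_convolution hβ hβ2 h1 ht hl (U := fun s => fourierTilde
      (fun x => N x s) k) hW hU
      (V := fun s => 1 / (Real.Gamma (⌈β⌉₊ - β) : ℂ) * ∫ τ in Ioo 0 t,
        (causalPow (⌈β⌉₊ - β) (s - τ) : ℂ) *
          fourierTilde (fun x => iteratedDeriv ⌈β⌉₊ (N x) τ) k) ?_ ?_ ?_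
    · refine Integrable.congr ((integrableOn_mlKernel_mul_integral hβ hβ2 hc (by linarith) hl
        hW).const_mul (1 / (Real.Gamma (⌈β⌉₊ - β) : ℂ))) (ae_of_all _ fun s => ?_)
      ring
    · have h := setIntegral_mlKernel_mul_integral hβ hβ2 hc (by linarith) hl hW
      simp only [mul_left_comm _ (1 / (Real.Gamma (⌈β⌉₊ - β) : ℂ)) _]
      rw [integral_const_mul, h, ← integral_const_mul, hβc]
      refine setIntegral_congr_fun measurableSet_Ioo fun τ _ => ?_
      push_cast
      field_simp
    -- Exchanging the transform with the Caputo integral is justified only for almost every `s`,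
    -- which suffices under the integral against the kernel.
    · filter_upwards [ae_restrict_mem measurableSet_Ioo,
        ae_integrable_causalPow_mul hc hstrip] with s hs hs'
      rw [hN.fourierTilde_source_eq hs.1 (hφ s hs.1),
        ← fourierTilde_integral (κ := fun τ => (causalPow (⌈β⌉₊ - β) (s - τ) : ℂ))
          (F := fun x τ => iteratedDeriv ⌈β⌉₊ (N x) τ) hs' k]
      simp_rw [caputoDeriv_eq _ hm (Ioo_subset_Ioc_self hs)]
      rw [fourierTilde_const_mul]

/-! ### Absolute convergence and Fourier inversion -/

lemma integrable_mul_mittagLeffler_mul_cexp {h : ℝ → ℂ} (hh : Integrable h) {η α β b C t : ℝ}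
    (hη : 0 < η) (hα : 0 < α) (hβ : 0 < β) (hb : 0 < b) (ht : 0 ≤ t)
    (hC : ∀ x : ℝ, 0 ≤ x → ‖mittagLeffler β b ((-x : ℝ) : ℂ)‖ ≤ C) (x : ℝ) :
    Integrable fun k : ℝ => h k * mittagLeffler β b ((-(η * |k| ^ α * t ^ β) : ℝ) : ℂ) *
      Complex.exp (-(Complex.I * k * x)) := by
  have hc : Continuous fun k : ℝ => mittagLeffler β b ((-(η * |k| ^ α * t ^ β) : ℝ) : ℂ) :=
    (continuous_mittagLeffler hβ hb).comp (Complex.continuous_ofReal.comp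
      ((continuous_const.mul (continuous_abs.rpow_const fun _ => Or.inr hα.le)).mul
        continuous_const).neg)
  exact (hh.mul_bdd hc.aestronglyMeasurable (ae_of_all _ fun k => hC _ (by positivity))).mul_bdd
    (c := 1) (by fun_prop) (ae_of_all _ fun k => (norm_cexp_neg_I_mul k x).le)

/-- The kernel is the weight `(t-s)^(β-1)` times the factor `E_{β,β}`, bounded uniformly in `k` and
`s`. -/
lemma integrable_mlKernel_mul_source {η α β t : ℝ} {Φ : ℝ → ℝ → ℂ} (hη : 0 < η) (hα : 0 < α)
    (hβ : 0 < β) (hβ2 : β ≤ 2)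
    (hΦ : Integrable (fun p : ℝ × ℝ => (((t - p.2) ^ (β - 1) : ℝ) : ℂ) * Φ p.1 p.2)
      (volume.prod (volume.restrict (Ioo 0 t)))) :
    Integrable (fun p : ℝ × ℝ => mlKernel β (η * |p.1| ^ α) (t - p.2) * Φ p.1 p.2)
      (volume.prod (volume.restrict (Ioo 0 t))) := by
  obtain ⟨C, hC⟩ := exists_norm_mittagLeffler_self_neg_le hβ hβ2
  have hc : Continuous fun p : ℝ × ℝ =>
      mittagLeffler β β ((-(η * |p.1| ^ α * (t - p.2) ^ β) : ℝ) : ℂ) :=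
    (continuous_mittagLeffler hβ hβ).comp (Complex.continuous_ofReal.comp
      ((continuous_const.mul (continuous_fst.abs.rpow_const fun _ => Or.inr hα.le)).mul
        ((continuous_const.sub continuous_snd).rpow_const fun _ => Or.inr hβ.le)).neg)
  have hmem : ∀ᵐ p : ℝ × ℝ ∂volume.prod (volume.restrict (Ioo 0 t)), p.2 ∈ Ioo 0 t :=
    Measure.quasiMeasurePreserving_snd.ae (ae_restrict_mem measurableSet_Ioo)
  refine (hΦ.mul_bdd (c := C) hc.aestronglyMeasurable ?_).congr (ae_of_all _ fun p => ?_)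
  · filter_upwards [hmem] with p hp
    have : 0 < t - p.2 := sub_pos.2 hp.2
    exact hC _ (by positivity)
  · simp only [mlKernel]
    ring

lemma measurePreserving_sub_left_Ioo (t : ℝ) : MeasurePreserving (fun ξ : ℝ => t - ξ)
    (volume.restrict (Ioo 0 t)) (volume.restrict (Ioo 0 t)) := by
  have h := (Measure.measurePreserving_sub_left volume t).restrict_preimage
    (measurableSet_Ioo (a := (0 : ℝ)) (b := t))
  rwa [preimage_const_sub_Ioo, sub_self, sub_zero] at h

theorem mainTheorem1 (η α β : ℝ) (hη : 0 < η) (hα : 0 < α) (hβ : 0 < β) (hβ2 : β ≤ 2)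
    (f g : ℝ → ℂ) (φ N : ℝ → ℝ → ℂ)
    (hf : Integrable f) (hf' : Integrable (fourierTilde f))
    (hg : Integrable g) (hg' : Integrable (fourierTilde g))
    (hφ : ∀ t : ℝ, 0 < t → Integrable fun x => φ x t)
    (hφ' : ∀ t : ℝ, 0 < t → Integrable
      (fun p : ℝ × ℝ => (((t - p.2) ^ (β - 1) : ℝ) : ℂ) * fourierTilde (fun x => φ x p.2) p.1)
      (volume.prod (volume.restrict (Ioo 0 t))))
    (hN : IsSolution η α β φ f g N) (x t : ℝ) (ht : 0 < t) :
    Integrable (fun k : ℝ => fourierTilde f k *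
        mittagLeffler β 1 ((-(η * |k| ^ α * t ^ β) : ℝ) : ℂ) *
        Complex.exp (-(Complex.I * k * x))) ∧
    Integrable (fun k : ℝ => (t : ℂ) * fourierTilde g k *
        mittagLeffler β 2 ((-(η * |k| ^ α * t ^ β) : ℝ) : ℂ) *
        Complex.exp (-(Complex.I * k * x))) ∧
    (∀ᵐ ξ ∂(volume.restrict (Ioo 0 t)),
      Integrable fun k : ℝ => fourierTilde (fun y => φ y (t - ξ)) k *
        mittagLeffler β β ((-(η * |k| ^ α * ξ ^ β) : ℝ) : ℂ) *
        Complex.exp (-(Complex.I * k * x))) ∧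
    IntervalIntegrable (fun ξ : ℝ => ((ξ ^ (β - 1) : ℝ) : ℂ) *
      ∫ k : ℝ, fourierTilde (fun y => φ y (t - ξ)) k *
        mittagLeffler β β ((-(η * |k| ^ α * ξ ^ β) : ℝ) : ℂ) *
        Complex.exp (-(Complex.I * k * x))) volume 0 t ∧
    N x t =
      1 / (2 * (Real.pi : ℂ)) * (∫ k : ℝ, fourierTilde f k *
          mittagLeffler β 1 ((-(η * |k| ^ α * t ^ β) : ℝ) : ℂ) *
          Complex.exp (-(Complex.I * k * x)))
      + (if 1 < β then
          1 / (2 * (Real.pi : ℂ)) * (∫ k : ℝ, (t : ℂ) * fourierTilde g k *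
            mittagLeffler β 2 ((-(η * |k| ^ α * t ^ β) : ℝ) : ℂ) *
            Complex.exp (-(Complex.I * k * x)))
        else 0)
      + 1 / (2 * (Real.pi : ℂ)) * (∫ ξ in (0 : ℝ)..t, ((ξ ^ (β - 1) : ℝ) : ℂ) *
          ∫ k : ℝ, fourierTilde (fun y => φ y (t - ξ)) k *
            mittagLeffler β β ((-(η * |k| ^ α * ξ ^ β) : ℝ) : ℂ) *
            Complex.exp (-(Complex.I * k * x))) := by
  set μ := volume.restrict (Ioo 0 t) with hμ
  set A : ℝ → ℝ → ℂ := fun k s => mlKernel β (η * |k| ^ α) (t - s) *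
    fourierTilde (fun y => φ y s) k with hA
  set J : ℝ → ℝ → ℂ := fun k s => A k s * Complex.exp (-(Complex.I * k * x)) with hJ
  obtain ⟨C, hC⟩ := exists_norm_mittagLeffler_self_neg_le hβ hβ2
  have hAint : Integrable (fun p : ℝ × ℝ => A p.1 p.2) (volume.prod μ) :=
    integrable_mlKernel_mul_source (Φ := fun k s => fourierTilde (fun y => φ y s) k)
      hη hα hβ hβ2 (hφ' t ht)
  have hJint : Integrable (fun p : ℝ × ℝ => J p.1 p.2) (volume.prod μ) :=
    hAint.mul_bdd (c := 1) (by fun_prop) (ae_of_all _ fun p => (norm_cexp_neg_I_mul p.1 x).le)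
  have hρ := measurePreserving_sub_left_Ioo t
  have hJρ : ∀ ξ, (fun k => J k (t - ξ)) = fun k : ℝ => ((ξ ^ (β - 1) : ℝ) : ℂ) *
      (fourierTilde (fun y => φ y (t - ξ)) k *
        mittagLeffler β β ((-(η * |k| ^ α * ξ ^ β) : ℝ) : ℂ) *
        Complex.exp (-(Complex.I * k * x))) := fun ξ => by
    funext k
    simp only [hJ, hA, mlKernel, sub_sub_cancel]
    ring
  have hJρ' : (fun ξ => ∫ k, J k (t - ξ)) = fun ξ : ℝ => ((ξ ^ (β - 1) : ℝ) : ℂ) *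
      ∫ k : ℝ, fourierTilde (fun y => φ y (t - ξ)) k *
        mittagLeffler β β ((-(η * |k| ^ α * ξ ^ β) : ℝ) : ℂ) *
        Complex.exp (-(Complex.I * k * x)) := by
    funext ξ
    rw [hJρ, integral_const_mul]
  have i1 := integrable_mul_mittagLeffler_mul_cexp hf' hη hα hβ one_pos ht.le
    (fun x hx => by
      rw [Complex.ofReal_one]; exact norm_mittagLeffler_one_neg_le hβ hβ2 hx) x
  have i2 := integrable_mul_mittagLeffler_mul_cexp (hg'.const_mul (t : ℂ)) hη hα hβ two_pos ht.le
    (fun x hx => by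
      rw [Complex.ofReal_ofNat]; exact norm_mittagLeffler_two_neg_le hβ hβ2 hx) x
  rw [Complex.ofReal_one] at i1
  rw [Complex.ofReal_ofNat] at i2
  have i3 : Integrable fun k => ∫ s, J k s ∂μ := hJint.integral_prod_left
  have i2' : Integrable fun k : ℝ => if 1 < β then (t : ℂ) * fourierTilde g k *
      mittagLeffler β 2 ((-(η * |k| ^ α * t ^ β) : ℝ) : ℂ) *
        Complex.exp (-(Complex.I * k * x)) else 0 := by
    split_ifs
    · exact i2
    · exact integrable_zero _ _ _
  have hsol : ∀ k, fourierTilde (fun x => N x t) k * Complex.exp (-(Complex.I * k * x)) =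
      fourierTilde f k * mittagLeffler β 1 ((-(η * |k| ^ α * t ^ β) : ℝ) : ℂ) *
        Complex.exp (-(Complex.I * k * x)) +
      (if 1 < β then (t : ℂ) * fourierTilde g k *
        mittagLeffler β 2 ((-(η * |k| ^ α * t ^ β) : ℝ) : ℂ) *
        Complex.exp (-(Complex.I * k * x)) else 0) + ∫ s, J k s ∂μ := fun k => by
    rw [hN.fourierTilde_eq_mittagLeffler hη hβ hβ2 hf hg hφ ht k]
    simp only [hJ]
    rw [integral_mul_const]
    split_ifs <;> ring
  -- Integrability of `Ñ(·,t)` is not assumed: it is read off the solution formula after removing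
  -- the unimodular exponential.
  have hNint : Integrable (fourierTilde fun x => N x t) := by
    have h := ((i1.add i2').add i3).mul_bdd (c := 1)
      (g := fun k : ℝ => Complex.exp (Complex.I * k * x)) (by fun_prop)
      (ae_of_all _ fun k => (norm_cexp_I_mul k x).le)
    refine h.congr (ae_of_all _ fun k => ?_)
    simp only [Pi.add_apply]
    rw [← hsol k, mul_assoc, ← Complex.exp_add, neg_add_cancel, Complex.exp_zero, mul_one]
  obtain ⟨v, hv, -⟩ := hN.equation t ht
  refine ⟨i1, i2, ?_, ?_, ?_⟩
  · filter_upwards [hρ.quasiMeasurePreserving.ae hJint.prod_left_ae,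
      ae_restrict_mem measurableSet_Ioo] with ξ hξ hξ'
    rw [hJρ] at hξ
    refine (hξ.const_mul ((ξ ^ (β - 1) : ℝ) : ℂ)⁻¹).congr (ae_of_all _ fun k => ?_)
    have : ((ξ ^ (β - 1) : ℝ) : ℂ) ≠ 0 := by
      exact_mod_cast (Real.rpow_pos_of_pos hξ'.1 _).ne'
    simp only
    rw [inv_mul_cancel_left₀ this]
  · rw [← hJρ', intervalIntegrable_iff_integrableOn_Ioo_of_le ht.le]
    exact hρ.integrable_comp_of_integrable hJint.integral_prod_right
  · rw [eq_integral_fourierTilde (hN.continuous_space t ht) hv.integrable_left hNint x]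
    simp_rw [hsol]
    -- Fubini, then the substitution `ξ = t - s`.
    have e3 : ∫ k, ∫ s, J k s ∂μ = ∫ ξ in (0 : ℝ)..t, ((ξ ^ (β - 1) : ℝ) : ℂ) *
        ∫ k : ℝ, fourierTilde (fun y => φ y (t - ξ)) k *
          mittagLeffler β β ((-(η * |k| ^ α * ξ ^ β) : ℝ) : ℂ) *
          Complex.exp (-(Complex.I * k * x)) := by
      rw [integral_integral_swap hJint, ← hJρ', intervalIntegral.integral_comp_sub_left
        (fun s => ∫ k, J k s) t, sub_self, sub_zero, intervalIntegral.integral_of_le ht.le,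
        integral_Ioc_eq_integral_Ioo]
    rw [integral_add (by exact i1.add i2') i3, integral_add i1 i2', e3]
    split_ifs
    · ring
    · simp; ring
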